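/- Let $N,n\ge 0$ be integers, let $C$ be a real symmetric positive semidefinite $N\times N$ matrix and let $d\mu_C$ be the centered Gaussian measure of covariance $C$ on $\mathbb R^N$. Let $f_1,\dots,f_n$ be smooth real- or complex-valued functions on $\mathbb R^N$ all of whose partial derivatives of order at most $n-1$ (including the functions themselves) belong to $L^n(d\mu_C)$. Then $$\int d\mu_C(\vec\tau)\prod_{i=1}^n f_i(\vec\tau)=\sum_{\mathcal F}\int dw_{\mathcal F}\int d\mu_{C\otimes X^{\mathcal F}(w_{\mathcal F})}(\vec\tau_1,\dots,\vec\tau_n)\;\partial^C_{\mathcal F}\prod_{i=1}^n f_i(\vec\tau_i),$$ where: - $\mathcal F$ runs over all forests on the labeled vertices $1,\dots,n$, that is, over all acyclic sets of edges $\ell=(i,j)$, $i<j$, of the complete graph $K_n$, including the empty one; - $\int dw_{\mathcal F}$ is integration over $w_{\mathcal F}=(w_\ell)_{\ell\in\mathcal F}\in[0,1]^{\mathcal F}$ (no integration if $\mathcal F=\varnothing$); - $X^{\mathcal F}(w_{\mathcal F})$ is the symmetric $n\times n$ matrix with $X^{\mathcal F}_{ii}=1$ and, for $i\neq j$, $X^{\mathcal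 F}_{ij}$ equal to the infimum of the $w_\ell$ over the edges $\ell$ of the unique path in $\mathcal F$ from $i$ to $j$, and to $0$ if there is no such path; - $d\mu_{C\otimes X}$ is the centered Gaussian measure on $n$ replicas $\vec\tau_i=(\tau_{p,i})_{1\le p\le N}$ of $\vec\tau$ with covariance $(C\otimes X)_{p,i;\,q,j}=C_{pq}X_{ij}$; - $\partial^C_{\mathcal F}=\prod_{\ell=(i,j)\in\mathcal F}\Bigl(\sum_{p,q}\frac{\partial}{\partial\tau_{p,i}}\,C_{pq}\,\frac{\partial}{\partial\tau_{q,j}}\Bigr)$. Moreover, for every forest $\mathcal F$ and every $w_{\mathcal F}\in[0,1]^{\mathcal F}$ the matrix $X^{\mathcal F}(w_{\mathcal F})$ is positive semidefinite (so the Gaussian measures above are well defined), and all the integrals above converge absolutely. -/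

import Mathlib

open MeasureTheory ProbabilityTheory
open scoped Kronecker ContDiff

namespace ReplicaForest

/-- The edges `(i, j)`, `i < j`, of the complete graph on the vertices `Fin n`. -/
abbrev Edge (n : ℕ) : Type := {e : Fin n × Fin n // e.1 < e.2}

/-- The edge-subgraph of the complete graph with vertex set `Fin n` and edge set `F`. -/
def graph {n : ℕ} (F : Finset (Edge n)) : SimpleGraph (Fin n) :=
  SimpleGraph.fromEdgeSet {s | ∃ e ∈ F, s = s(e.1.1, e.1.2)}

open Classical in
/-- All forests on the labelled vertices `Fin n` (including the empty one), as edge sets. -/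
noncomputable def forests (n : ℕ) : Finset (Finset (Edge n)) :=
  Finset.univ.filter fun F => (graph F).IsAcyclic

open Classical in
/-- The matrix `X^F(w)`: it has `1` on the diagonal; off the diagonal it is the infimum of the
`w ℓ` over the edges `ℓ` on the path in `F` from `i` to `j` (unique when `F` is a forest), and `0`
if there is no such path. -/
noncomputable def forestMatrix {n : ℕ} (F : Finset (Edge n)) (w : F → ℝ) :
    Matrix (Fin n) (Fin n) ℝ :=
  Matrix.of fun i j =>
    if i = j then 1
    else if (graph F).Reachable i j then
      sInf {x : ℝ | ∃ P : (graph F).Walk i j, P.IsPath ∧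
        ∃ ℓ : F, s(ℓ.1.1.1, ℓ.1.1.2) ∈ P.edges ∧ w ℓ = x}
    else 0

/-- The parameter cube `[0,1]^F`. -/
def unitCube {n : ℕ} (F : Finset (Edge n)) : Set (F → ℝ) :=
  Set.univ.pi fun _ => Set.Icc (0 : ℝ) 1

/-- The centred Gaussian measure of covariance `S`. -/
noncomputable def gaussian {ι : Type*} [Fintype ι] [DecidableEq ι] (S : Matrix ι ι ℝ) :
    Measure (EuclideanSpace ℝ ι) :=
  multivariateGaussian 0 S

/-- The `i`-th replica `τ_i`, with components `τ_{p,i}`. -/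
def replica {N n : ℕ} (τ : EuclideanSpace ℝ (Fin N × Fin n)) (i : Fin n) :
    EuclideanSpace ℝ (Fin N) :=
  WithLp.toLp 2 fun p => τ (p, i)

section Derivatives

variable {𝕜 : Type*} [RCLike 𝕜] {N n : ℕ}

/-- The partial derivative `∂ g / ∂ τ_{p,i}`, for `a = (p, i)`. -/
noncomputable def partialDeriv (a : Fin N × Fin n)
    (g : EuclideanSpace ℝ (Fin N × Fin n) → 𝕜) : EuclideanSpace ℝ (Fin N × Fin n) → 𝕜 :=
  fun τ => lineDeriv ℝ g τ (EuclideanSpace.single a 1)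

/-- The operator `∑_{p,q} ∂_{τ_{p,i}} C_{pq} ∂_{τ_{q,j}}` of the edge `ℓ = (i, j)`. -/
noncomputable def edgeOp (C : Matrix (Fin N) (Fin N) ℝ) (ℓ : Edge n)
    (g : EuclideanSpace ℝ (Fin N × Fin n) → 𝕜) : EuclideanSpace ℝ (Fin N × Fin n) → 𝕜 :=
  fun τ => ∑ p, ∑ q, C p q • partialDeriv (p, ℓ.1.1) (partialDeriv (q, ℓ.1.2) g) τ

/-- The operator `∂^C_F`, the product (composition) of the operators of the edges of `F`. The edges
are taken in an arbitrary order, which is immaterial on smooth functions since there the edge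
operators commute. -/
noncomputable def forestOp (C : Matrix (Fin N) (Fin N) ℝ) (F : Finset (Edge n))
    (g : EuclideanSpace ℝ (Fin N × Fin n) → 𝕜) : EuclideanSpace ℝ (Fin N × Fin n) → 𝕜 :=
  F.toList.foldr (edgeOp C) g

end Derivatives

end ReplicaForest

/-! On the Fourier side the theorem is an identity for the exponential of a linear form. Against a
Gaussian of covariance `C ⊗ₖ X` with unit diagonal `X`, the characteristic function at `(2π)ξ` is a
factor independent of `X` times `exp (∑ a_ℓ X_ℓ)`, where `a_ℓ` is the Fourier symbol of `edgeOp C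
ℓ`. The left side is the case where all entries of `X` are 1, because all replicas coincide. So for
Schwartz functions it suffices to expand `exp (∑ a_ℓ)` over forests, which is
`exp_sum_eq_sum_forests`.

That expansion telescopes. For a forest `F`, put a common parameter `t` on the entries of `X^F`
between different components and let `t` run from 0 to the smallest weight of `F`. Newton's formula
produces one term for each edge `e` joining two components, with `t` as the weight of `e`: the part
of the forest `F ∪ {e}` where `e` is lightest. Almost surely exactly one edge of a nonempty forest
is lightest, so summing these parts recovers the upper boundary terms of all nonempty forests. Only
the boundary term of the empty forest, `exp (∑ a_ℓ)`, survives.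

Positivity of `X^F(w)` is a layer-cake argument: `t ≤ X_ij` means that the edges of weight at least
`t` connect `i` and `j`, and the indicator matrix of an equivalence relation is positive
semidefinite.

General `f_i` are truncated smoothly, so that their product is a Schwartz function, and dominated
convergence removes the truncation. A vertex has degree at most `n - 1`, so at most `n - 1`
derivatives fall on each factor. Each replica has law `gaussian C` whatever `X` is
(`map_replica_gaussian`), so the `L^n` hypotheses give a bound uniform in the weights and the
truncation (`integral_dominator`). -/

namespace ReplicaForest

/-! ### Forests, their weight matrices, and positive semidefiniteness -/

section Graph

variable {n : ℕ} {F G : Finset (Edge n)} {e : Edge n} {i j : Fin n}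

lemma graph_adj : (graph F).Adj i j ↔ ∃ e ∈ F, s(i, j) = s(e.1.1, e.1.2) := by
  rw [graph, SimpleGraph.fromEdgeSet_adj]
  refine ⟨fun h => h.1, fun h => ⟨h, ?_⟩⟩
  rintro rfl
  obtain ⟨e, -, he⟩ := h
  have h1 := e.2
  rw [Sym2.eq_iff] at he
  rcases he with ⟨h2, h3⟩ | ⟨h2, h3⟩ <;> simp [← h2, ← h3] at h1

lemma mem_edgeSet_graph {s : Sym2 (Fin n)} :
    s ∈ (graph F).edgeSet ↔ ∃ e ∈ F, s = s(e.1.1, e.1.2) := by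
  induction s with
  | _ i j => rw [SimpleGraph.mem_edgeSet, graph_adj]

lemma edge_sym2_injective {e e' : Edge n} (h : s(e.1.1, e.1.2) = s(e'.1.1, e'.1.2)) : e = e' := by
  have h1 := e.2
  have h2 := e'.2
  rw [Sym2.eq_iff] at h
  rcases h with ⟨h3, h4⟩ | ⟨h3, h4⟩
  · exact Subtype.ext (Prod.ext h3 h4)
  · rw [h3, h4] at h1
    exact absurd h1 h2.asymm

lemma graph_mono (h : F ⊆ G) : graph F ≤ graph G := by
  intro i j hij
  rw [graph_adj] at hij ⊢
  obtain ⟨e, he, h1⟩ := hij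
  exact ⟨e, h he, h1⟩

lemma graph_insert [DecidableEq (Edge n)] :
    graph (insert e F) = graph F ⊔ SimpleGraph.edge e.1.1 e.1.2 := by
  ext i j
  rw [SimpleGraph.sup_adj, graph_adj, graph_adj, SimpleGraph.edge_adj]
  have h1 := e.2.ne
  constructor
  · rintro ⟨e', he', h⟩
    rcases Finset.mem_insert.1 he' with rfl | he'
    · right
      rw [Sym2.eq_iff] at h
      grind
    · exact Or.inl ⟨e', he', h⟩
  · rintro (⟨e', he', h⟩ | h)
    · exact ⟨e', Finset.mem_insert_of_mem he', h⟩
    · refine ⟨e, Finset.mem_insert_self _ _, ?_⟩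
      rw [Sym2.eq_iff]
      grind

lemma reachable_of_mem (he : e ∈ F) : (graph F).Reachable e.1.1 e.1.2 :=
  (graph_adj.2 ⟨e, he, rfl⟩ : (graph F).Adj _ _).reachable

/-- The end points of an edge of a forest are not connected by the other edges. -/
lemma not_reachable_of_isAcyclic_insert [DecidableEq (Edge n)] (he : e ∉ F)
    (h : (graph (insert e F)).IsAcyclic) : ¬ (graph F).Reachable e.1.1 e.1.2 := by
  rw [graph_insert, SimpleGraph.isAcyclic_sup_fromEdgeSet_iff] at h
  intro hr
  rcases h.2 hr with h | h
  · exact e.2.ne h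
  · obtain ⟨e', he', h'⟩ := graph_adj.1 h
    exact he (edge_sym2_injective h' ▸ he')

lemma isAcyclic_insert [DecidableEq (Edge n)] (hF : (graph F).IsAcyclic)
    (h : ¬ (graph F).Reachable e.1.1 e.1.2) : (graph (insert e F)).IsAcyclic := by
  rw [graph_insert]
  exact hF.sup_edge_of_not_reachable h

/-- The edges of the path joining two vertices of a forest. -/
lemma exists_pathEdges (hF : (graph F).IsAcyclic) (hij : i ≠ j) (hr : (graph F).Reachable i j) :
    ∃ L : Finset (Edge n), L.Nonempty ∧ L ⊆ F ∧
      (∀ G ⊆ F, (graph G).Reachable i j ↔ L ⊆ G) ∧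
      ∀ w : F → ℝ, forestMatrix F w i j = sInf {x | ∃ ℓ : F, ℓ.1 ∈ L ∧ w ℓ = x} := by
  classical
  obtain ⟨P, hP⟩ := hr.exists_isPath
  have huniq : ∀ Q : (graph F).Walk i j, Q.IsPath → Q = P := fun Q hQ =>
    congrArg Subtype.val ((hF.subsingleton_path i j).elim ⟨Q, hQ⟩ ⟨P, hP⟩)
  refine ⟨F.filter fun e => s(e.1.1, e.1.2) ∈ P.edges, ?_, Finset.filter_subset _ _, ?_, ?_⟩
  · cases P with
    | nil => exact absurd rfl hij
    | cons h P =>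
      obtain ⟨e, he, h'⟩ := graph_adj.1 h
      exact ⟨e, Finset.mem_filter.2 ⟨he, by rw [← h']; simp⟩⟩
  · intro G hG
    constructor
    · intro hr e he
      obtain ⟨Q, hQ⟩ := hr.exists_isPath
      -- A path inside `G` is also a path in the forest `F`, hence it is `P`, and `G` contains all
      -- edges of `P`.
      have h1 := huniq (Q.mapLe (graph_mono hG)) (hQ.mapLe _)
      rw [Finset.mem_filter, ← h1, SimpleGraph.Walk.edges_mapLe_eq_edges] at he
      obtain ⟨e', he', h2⟩ := mem_edgeSet_graph.1 (Q.edges_subset_edgeSet he.2)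
      exact edge_sym2_injective h2 ▸ he'
    · intro hL
      refine ⟨P.transfer (graph G) fun s hs => ?_⟩
      obtain ⟨e, he, rfl⟩ := mem_edgeSet_graph.1 (P.edges_subset_edgeSet hs)
      exact mem_edgeSet_graph.2 ⟨e, hL (Finset.mem_filter.2 ⟨he, hs⟩), rfl⟩
  · intro w
    simp only [forestMatrix, Matrix.of_apply, if_neg hij, if_pos hr]
    congr 1
    ext x
    simp only [Set.mem_ofPred_eq, Finset.mem_filter]
    constructor
    · rintro ⟨Q, hQ, ℓ, h1, h2⟩
      rw [huniq Q hQ] at h1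
      exact ⟨ℓ, ⟨ℓ.2, h1⟩, h2⟩
    · rintro ⟨ℓ, ⟨-, h1⟩, h2⟩
      exact ⟨P, hP, ℓ, h1, h2⟩

/-- The matrix `X^F(w)`, with `w` given on all the edges of the complete graph. -/
noncomputable def weightMatrix (F : Finset (Edge n)) (w : Edge n → ℝ) : Matrix (Fin n) (Fin n) ℝ :=
  forestMatrix F fun ℓ => w ℓ

lemma weightMatrix_self (w : Edge n → ℝ) : weightMatrix F w i i = 1 := by
  simp [weightMatrix, forestMatrix]

lemma weightMatrix_of_not_reachable (h : ¬ (graph F).Reachable i j) (w : Edge n → ℝ) :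
    weightMatrix F w i j = 0 := by
  have hij : i ≠ j := by rintro rfl; exact h (SimpleGraph.Reachable.refl _)
  simp [weightMatrix, forestMatrix, hij, h]

lemma exists_weightMatrix_eq_inf' (hF : (graph F).IsAcyclic) (hij : i ≠ j)
    (hr : (graph F).Reachable i j) :
    ∃ (L : Finset (Edge n)) (hL : L.Nonempty), L ⊆ F ∧
      (∀ G ⊆ F, (graph G).Reachable i j ↔ L ⊆ G) ∧ ∀ w, weightMatrix F w i j = L.inf' hL w := by
  obtain ⟨L, hL, hLF, h1, h2⟩ := exists_pathEdges hF hij hr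
  refine ⟨L, hL, hLF, h1, fun w => ?_⟩
  rw [weightMatrix, h2, Finset.inf'_eq_csInf_image]
  congr 1
  ext x
  simp only [Set.mem_ofPred_eq, Set.mem_image, Finset.mem_coe]
  constructor
  · rintro ⟨ℓ, h3, h4⟩
    exact ⟨ℓ, h3, h4⟩
  · rintro ⟨ℓ, h3, h4⟩
    exact ⟨⟨ℓ, hLF h3⟩, h3, h4⟩

/-- A minimum along the path is at least `t` exactly when every edge of the path survives the
threshold `t`. Through this description, symmetry, positivity and the effect of adding an edge all
become statements about connectedness. -/
lemma le_weightMatrix_iff (hF : (graph F).IsAcyclic) (hij : i ≠ j) (hr : (graph F).Reachable i j)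
    (w : Edge n → ℝ) (t : ℝ) :
    t ≤ weightMatrix F w i j ↔ (graph (F.filter fun e => t ≤ w e)).Reachable i j := by
  obtain ⟨L, hL, hLF, h1, h2⟩ := exists_weightMatrix_eq_inf' hF hij hr
  rw [h2, Finset.le_inf'_iff, h1 _ (Finset.filter_subset _ _)]
  exact ⟨fun h e he => Finset.mem_filter.2 ⟨hLF he, h e he⟩,
    fun h e he => (Finset.mem_filter.1 (h he)).2⟩

/-- The bound `t ≤ 1` handles the diagonal, and `0 < t` handles pairs in different components. -/
lemma le_weightMatrix_iff_of_mem_Ioc (hF : (graph F).IsAcyclic) (w : Edge n → ℝ) {t : ℝ}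
    (ht : t ∈ Set.Ioc (0 : ℝ) 1) :
    t ≤ weightMatrix F w i j ↔ (graph (F.filter fun e => t ≤ w e)).Reachable i j := by
  by_cases hij : i = j
  · subst hij
    simpa [weightMatrix_self] using ht.2
  by_cases hr : (graph F).Reachable i j
  · exact le_weightMatrix_iff hF hij hr w t
  · rw [weightMatrix_of_not_reachable hr]
    exact ⟨fun h => absurd ht.1 h.not_gt,
      fun h => absurd (h.mono (graph_mono (Finset.filter_subset _ _))) hr⟩

lemma measurable_weightMatrix (hF : (graph F).IsAcyclic) :
    Measurable fun w : Edge n → ℝ => weightMatrix F w i j := by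
  by_cases hij : i = j
  · subst hij
    simp [weightMatrix_self]
  by_cases hr : (graph F).Reachable i j
  · obtain ⟨L, hL, -, -, h2⟩ := exists_weightMatrix_eq_inf' hF hij hr
    simp only [h2]
    exact (Continuous.finset_inf'_apply hL fun e _ => continuous_apply e).measurable
  · simp [weightMatrix_of_not_reachable hr]

lemma weightMatrix_mem_Icc (hF : (graph F).IsAcyclic) {w : Edge n → ℝ}
    (hw : ∀ e ∈ F, w e ∈ Set.Icc (0 : ℝ) 1) : weightMatrix F w i j ∈ Set.Icc (0 : ℝ) 1 := by
  by_cases hij : i = j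
  · subst hij
    simp [weightMatrix_self]
  by_cases hr : (graph F).Reachable i j
  · obtain ⟨L, hL, hLF, -, h2⟩ := exists_weightMatrix_eq_inf' hF hij hr
    rw [h2]
    obtain ⟨e, he, h3⟩ := Finset.exists_mem_eq_inf' hL w
    rw [h3]
    exact hw e (hLF he)
  · simp [weightMatrix_of_not_reachable hr]

lemma weightMatrix_symm (hF : (graph F).IsAcyclic) (w : Edge n → ℝ) :
    weightMatrix F w i j = weightMatrix F w j i := by
  by_cases hij : i = j
  · rw [hij]
  by_cases hr : (graph F).Reachable i j
  · refine eq_of_forall_le_iff fun t => ?_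
    rw [le_weightMatrix_iff hF hij hr, le_weightMatrix_iff hF (Ne.symm hij) hr.symm]
    exact SimpleGraph.reachable_comm
  · rw [weightMatrix_of_not_reachable hr,
      weightMatrix_of_not_reachable (fun h => hr h.symm)]

open Classical in
-- The quadratic form of an equivalence relation is the sum, over its classes, of the squared sum of
-- `x` on the class.
lemma sum_mul_reachable_nonneg {V : Type*} [Fintype V] (H : SimpleGraph V) (x : V → ℝ) :
    0 ≤ ∑ i, ∑ j, x i * x j * (if H.Reachable i j then 1 else 0 : ℝ) := by
  have h : ∀ i j, x i * x j * (if H.Reachable i j then 1 else 0 : ℝ) =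
      ∑ c : H.ConnectedComponent, (x i * if H.connectedComponentMk i = c then 1 else 0 : ℝ) *
        (x j * if H.connectedComponentMk j = c then 1 else 0 : ℝ) := by
    intro i j
    have h1 : ∀ c, (x i * if H.connectedComponentMk i = c then 1 else 0 : ℝ) *
        (x j * if H.connectedComponentMk j = c then 1 else 0 : ℝ) =
        if H.connectedComponentMk i = c then
          (x i * (x j * if H.connectedComponentMk j = c then 1 else 0 : ℝ)) else 0 := by
      intro c
      split_ifs <;> simp
    simp_rw [h1]
    rw [Finset.sum_ite_eq]
    simp only [Finset.mem_univ, if_true, SimpleGraph.ConnectedComponent.eq,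
      SimpleGraph.reachable_comm (u := j), mul_assoc]
  have : ∑ i, ∑ j, x i * x j * (if H.Reachable i j then 1 else 0 : ℝ) =
      ∑ c : H.ConnectedComponent,
        (∑ i, x i * (if H.connectedComponentMk i = c then 1 else 0 : ℝ)) ^ 2 := by
    simp_rw [h, sq, Finset.sum_mul_sum]
    conv_lhs =>
      enter [2, i]
      rw [Finset.sum_comm]
    rw [Finset.sum_comm]
  rw [this]
  positivity

open Classical in
-- Layer-cake formula: a number in `[0, 1]` is the length of the set of thresholds in `(0, 1]` below
-- it.
lemma weightMatrix_eq_integral (hF : (graph F).IsAcyclic) {w : Edge n → ℝ}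
    (hw : ∀ e ∈ F, w e ∈ Set.Icc (0 : ℝ) 1) :
    IntegrableOn (fun t => if (graph (F.filter fun e => t ≤ w e)).Reachable i j then 1 else 0 : ℝ → ℝ)
      (Set.Ioc 0 1) ∧
    weightMatrix F w i j = ∫ t in Set.Ioc (0 : ℝ) 1,
      if (graph (F.filter fun e => t ≤ w e)).Reachable i j then 1 else 0 := by
  have hX := weightMatrix_mem_Icc (i := i) (j := j) hF hw
  have h1 : Set.EqOn ((Set.Iic (weightMatrix F w i j)).indicator (fun _ => (1 : ℝ)))
      (fun t => if (graph (F.filter fun e => t ≤ w e)).Reachable i j then 1 else 0)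
      (Set.Ioc 0 1) := by
    intro t ht
    simp only [Set.indicator_apply, Set.mem_Iic, le_weightMatrix_iff_of_mem_Ioc hF w ht]
  refine ⟨IntegrableOn.congr_fun ?_ h1 measurableSet_Ioc, ?_⟩
  · exact (integrable_const _).indicator measurableSet_Iic
  · rw [← setIntegral_congr_fun measurableSet_Ioc h1, integral_indicator measurableSet_Iic,
      Measure.restrict_restrict measurableSet_Iic, Set.Iic_inter_Ioc_of_le hX.2]
    simp [hX.1]

/-- The forest matrix is positive semidefinite: it is the average over `t ∈ [0, 1]` of the
indicator matrices of the connectedness relation of the edges of weight at least `t`. -/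
lemma posSemidef_weightMatrix (hF : (graph F).IsAcyclic) {w : Edge n → ℝ}
    (hw : ∀ e ∈ F, w e ∈ Set.Icc (0 : ℝ) 1) : (weightMatrix F w).PosSemidef := by
  classical
  refine Matrix.PosSemidef.of_dotProduct_mulVec_nonneg ?_ fun x => ?_
  · ext i j
    simpa using weightMatrix_symm hF w
  · have hint : ∀ i j, IntegrableOn (fun t => x i * x j *
        (if (graph (F.filter fun e => t ≤ w e)).Reachable i j then 1 else 0 : ℝ))
        (Set.Ioc 0 1) := fun i j => (weightMatrix_eq_integral hF hw).1.const_mul _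
    have h1 : star x ⬝ᵥ Matrix.mulVec (weightMatrix F w) x =
        ∫ t in Set.Ioc (0 : ℝ) 1, ∑ i, ∑ j, x i * x j *
          (if (graph (F.filter fun e => t ≤ w e)).Reachable i j then 1 else 0 : ℝ) := by
      rw [integral_finsetSum _ fun i _ => integrable_finsetSum _ fun j _ => hint i j]
      simp only [dotProduct, Matrix.mulVec, star_trivial, Finset.mul_sum]
      refine Finset.sum_congr rfl fun i _ => ?_
      rw [integral_finsetSum _ fun j _ => hint i j]
      refine Finset.sum_congr rfl fun j _ => ?_
      rw [integral_const_mul, ← (weightMatrix_eq_integral hF hw).2]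
      ring
    rw [h1]
    refine setIntegral_nonneg measurableSet_Ioc fun t _ => ?_
    convert sum_mul_reachable_nonneg (graph (F.filter fun e => t ≤ w e)) x

open Classical in
-- The value 0 off `F` is arbitrary, since only the weights on `F` are read.
lemma forestMatrix_eq_weightMatrix (w : F → ℝ) :
    forestMatrix F w = weightMatrix F fun e => if h : e ∈ F then w ⟨e, h⟩ else 0 := by
  rw [weightMatrix]
  congr 1
  ext e
  simp

lemma measurable_forestMatrix (hF : (graph F).IsAcyclic) :
    Measurable fun w : F → ℝ => forestMatrix F w i j := by
  classical
  have hm : Measurable fun (w : F → ℝ) (e : Edge n) => if h : e ∈ F then w ⟨e, h⟩ else 0 := by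
    refine measurable_pi_lambda _ fun e => ?_
    by_cases h : e ∈ F
    · simp only [h, dite_true]
      exact measurable_pi_apply _
    · simp [h]
  have h1 := (measurable_weightMatrix (i := i) (j := j) hF).comp hm
  convert h1 using 1
  ext w
  rw [forestMatrix_eq_weightMatrix]
  rfl

lemma posSemidef_forestMatrix (hF : (graph F).IsAcyclic) {w : F → ℝ} (hw : w ∈ unitCube F) :
    (forestMatrix F w).PosSemidef := by
  classical
  rw [forestMatrix_eq_weightMatrix]
  refine posSemidef_weightMatrix hF fun e he => ?_
  simpa [he] using hw ⟨e, he⟩ trivial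

lemma forestMatrix_self (w : F → ℝ) : forestMatrix F w i i = 1 := by
  simp [forestMatrix]

end Graph

end ReplicaForest

namespace ReplicaForest

/-! ### The uniform measure on the cube -/

section Cube

variable {ι : Type*} [Fintype ι]

instance isProbabilityMeasure_restrict_Icc :
    IsProbabilityMeasure (volume.restrict (Set.Icc (0 : ℝ) 1)) :=
  ⟨by simp⟩

/-- The uniform measure on the cube `[0, 1]^ι`. -/
noncomputable def cubeMeasure (ι : Type*) [Fintype ι] : Measure (ι → ℝ) :=
  Measure.pi fun _ => volume.restrict (Set.Icc (0 : ℝ) 1)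

instance isProbabilityMeasure_cubeMeasure : IsProbabilityMeasure (cubeMeasure ι) := by
  unfold cubeMeasure
  infer_instance

lemma cubeMeasure_eq_restrict :
    cubeMeasure ι = volume.restrict (Set.univ.pi fun _ => Set.Icc (0 : ℝ) 1) := by
  rw [cubeMeasure, ← Measure.restrict_pi_pi, volume_pi]

lemma ae_cubeMeasure_mem : ∀ᵐ w ∂cubeMeasure ι, ∀ i, w i ∈ Set.Icc (0 : ℝ) 1 := by
  rw [cubeMeasure_eq_restrict]
  filter_upwards [ae_restrict_mem (MeasurableSet.univ_pi fun _ => measurableSet_Icc)] with w hw i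
  exact hw i trivial

/-- Resampling one coordinate preserves the uniform measure. -/
lemma measurePreserving_update [DecidableEq ι] (i : ι) :
    MeasurePreserving (fun p : (ι → ℝ) × ℝ => Function.update p.1 i p.2)
      ((cubeMeasure ι).prod (volume.restrict (Set.Icc (0 : ℝ) 1))) (cubeMeasure ι) := by
  have hm : Measurable fun p : (ι → ℝ) × ℝ => Function.update p.1 i p.2 := by
    refine measurable_pi_lambda _ fun j => ?_
    by_cases h : j = i
    · subst h
      simpa using measurable_snd
    · simp only [Function.update_of_ne h]
      exact (measurable_pi_apply j).comp measurable_fst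
  refine ⟨hm, (Measure.pi_eq fun s hs => ?_).symm⟩
  rw [Measure.map_apply hm (MeasurableSet.univ_pi hs)]
  -- The old `i`-th coordinate is forgotten, so the preimage of a box is the box with its `i`-th
  -- side freed, times that side.
  have h1 : (fun p : (ι → ℝ) × ℝ => Function.update p.1 i p.2) ⁻¹' Set.univ.pi s =
      (Set.univ.pi (Function.update s i Set.univ)) ×ˢ s i := by
    ext p
    simp only [Set.mem_preimage, Set.mem_pi, Set.mem_univ, true_implies, Set.mem_prod]
    constructor
    · intro h
      refine ⟨fun j => ?_, by simpa using h i⟩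
      by_cases hj : j = i
      · subst hj; simp
      · simpa [hj] using h j
    · rintro ⟨h, h'⟩ j
      by_cases hj : j = i
      · subst hj; simpa using h'
      · simpa [hj] using h j
  rw [h1, Measure.prod_prod, cubeMeasure, Measure.pi_pi,
    ← Finset.mul_prod_erase Finset.univ _ (Finset.mem_univ i),
    ← Finset.mul_prod_erase Finset.univ (fun j => volume.restrict (Set.Icc (0 : ℝ) 1) (s j))
      (Finset.mem_univ i), Function.update_self, measure_univ, one_mul, mul_comm]
  congr 1
  refine Finset.prod_congr rfl fun j hj => ?_
  rw [Function.update_of_ne (Finset.ne_of_mem_erase hj)]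

lemma measurePreserving_restrict_cube (s : Finset ι) :
    MeasurePreserving (fun (w : ι → ℝ) (i : s) => w i) (cubeMeasure ι) (cubeMeasure s) := by
  classical
  have hm : Measurable fun (w : ι → ℝ) (i : s) => w i := by fun_prop
  refine ⟨hm, (Measure.pi_eq fun t ht => ?_).symm⟩
  rw [Measure.map_apply hm (MeasurableSet.univ_pi ht)]
  have h1 : (fun (w : ι → ℝ) (i : s) => w i) ⁻¹' Set.univ.pi t =
      Set.univ.pi fun i => if h : i ∈ s then t ⟨i, h⟩ else Set.univ := by
    ext w
    simp only [Set.mem_preimage, Set.mem_pi, Set.mem_univ, true_implies]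
    constructor
    · intro h i
      by_cases hi : i ∈ s
      · simpa [hi] using h ⟨i, hi⟩
      · simp [hi]
    · intro h i
      simpa using h i
  rw [h1, cubeMeasure, Measure.pi_pi, ← Finset.prod_subset (Finset.subset_univ s),
    ← Finset.prod_coe_sort s]
  · refine Finset.prod_congr rfl fun i _ => ?_
    simp
  · intro i _ hi
    simp [hi]

/-- Distinct coordinates of a point of the cube are almost surely different. -/
lemma ae_cubeMeasure_injective : ∀ᵐ w ∂cubeMeasure ι, Function.Injective w := by
  classical
  have h : ∀ i j : ι, i ≠ j → ∀ᵐ w ∂cubeMeasure ι, w i ≠ w j := by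
    intro i j hij
    rw [ae_iff]
    simp only [not_not]
    have hms : MeasurableSet {w : ι → ℝ | w i = w j} :=
      measurableSet_eq_fun (measurable_pi_apply i) (measurable_pi_apply j)
    -- Resample coordinate `i` with the others fixed: equality then picks out the single value `w
    -- j`, a null set.
    rw [← (measurePreserving_update i).measure_preimage hms.nullMeasurableSet,
      Measure.measure_prod_null ((measurePreserving_update i).measurable hms)]
    refine Filter.Eventually.of_forall fun w => ?_
    have h2 : Prod.mk w ⁻¹' ((fun p : (ι → ℝ) × ℝ => Function.update p.1 i p.2) ⁻¹'
        {w : ι → ℝ | w i = w j}) = {w j} := by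
      ext t
      simp [Function.update_of_ne hij.symm]
    simp only [h2, Pi.zero_apply]
    simp
  have h' : ∀ᵐ w ∂cubeMeasure ι, ∀ i j : ι, i ≠ j → w i ≠ w j := by
    simp only [Filter.eventually_all]
    exact h
  filter_upwards [h'] with w hw i j hij
  by_contra hne
  exact hw i j hne hij

end Cube

end ReplicaForest

namespace ReplicaForest

/-! ### The forest expansion of an exponential -/

section ForestFormula

variable {n : ℕ} {F : Finset (Edge n)} {e : Edge n} {i j : Fin n}

lemma filter_eq_self_of_le {w : Edge n → ℝ} {s t : ℝ} (h : ∀ e ∈ F, t ≤ w e) (hst : s ≤ t) :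
    F.filter (fun e => s ≤ w e) = F :=
  Finset.filter_true_of_mem fun e he => hst.trans (h e he)

open Classical in
-- Compare level sets: thresholds up to `w e` keep every edge of both forests, and thresholds above
-- `w e` delete the new edge.
lemma weightMatrix_insert_of_reachable (hF : (graph F).IsAcyclic)
    (he : ¬ (graph F).Reachable e.1.1 e.1.2) (hij : i ≠ j) (hr : (graph F).Reachable i j)
    {w : Edge n → ℝ} (hw : ∀ e' ∈ F, w e ≤ w e') :
    weightMatrix (insert e F) w i j = weightMatrix F w i j := by
  have hr' := hr.mono (graph_mono (Finset.subset_insert e F))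
  refine eq_of_forall_le_iff fun s => ?_
  rw [le_weightMatrix_iff (isAcyclic_insert hF he) hij hr', le_weightMatrix_iff hF hij hr]
  rcases le_or_gt s (w e) with hs | hs
  · rw [filter_eq_self_of_le hw hs, filter_eq_self_of_le (t := w e) _ hs]
    · exact iff_of_true hr' hr
    · simpa using hw
  · rw [Finset.filter_insert, if_neg hs.not_ge]

open Classical in
-- The connection exists only through `e`, which is a lightest edge.
lemma weightMatrix_insert_of_not_reachable (hF : (graph F).IsAcyclic)
    (he : ¬ (graph F).Reachable e.1.1 e.1.2) (hr : ¬ (graph F).Reachable i j)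
    (hr' : (graph (insert e F)).Reachable i j) {w : Edge n → ℝ} (hw : ∀ e' ∈ F, w e ≤ w e') :
    weightMatrix (insert e F) w i j = w e := by
  have hij : i ≠ j := by rintro rfl; exact hr (SimpleGraph.Reachable.refl _)
  refine eq_of_forall_le_iff fun s => ?_
  rw [le_weightMatrix_iff (isAcyclic_insert hF he) hij hr']
  rcases le_or_gt s (w e) with hs | hs
  · rw [filter_eq_self_of_le (t := w e) _ hs]
    · exact iff_of_true hr' hs
    · simpa using hw
  · rw [Finset.filter_insert, if_neg hs.not_ge]
    exact iff_of_false (fun h => hr (h.mono (graph_mono (Finset.filter_subset _ _)))) hs.not_ge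

open Classical in
/-- The exponent `∑ a_{ij} X_{ij}`, where the entries of `X^F(w)` between different components of
the forest are replaced by `t`. -/
noncomputable def forestExponent (a : Edge n → ℝ) (F : Finset (Edge n)) (w : Edge n → ℝ) (t : ℝ) :
    ℝ :=
  ∑ e, a e * if (graph F).Reachable e.1.1 e.1.2 then weightMatrix F w e.1.1 e.1.2 else t

/-- The smallest weight of the edges of `F`, and `1` if there are none. -/
noncomputable def minWeight (F : Finset (Edge n)) (w : Edge n → ℝ) : ℝ :=
  F.fold min 1 w

lemma le_minWeight {w : Edge n → ℝ} {t : ℝ} : t ≤ minWeight F w ↔ t ≤ 1 ∧ ∀ e ∈ F, t ≤ w e :=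
  Finset.le_fold_min t

lemma measurable_minWeight : Measurable (minWeight F) := by
  refine measurable_of_Ici fun t => ?_
  have : minWeight F ⁻¹' Set.Ici t = {_w | t ≤ 1} ∩ ⋂ e ∈ F, {w | t ≤ w e} := by
    ext w
    simp [le_minWeight]
  rw [this]
  refine MeasurableSet.inter (MeasurableSet.const _) (Finset.measurableSet_biInter _ fun e _ => ?_)
  exact measurableSet_le measurable_const (measurable_pi_apply e)

lemma minWeight_mem_Icc {w : Edge n → ℝ} (hw : ∀ e, w e ∈ Set.Icc (0 : ℝ) 1) :
    minWeight F w ∈ Set.Icc (0 : ℝ) 1 :=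
  ⟨le_minWeight.2 ⟨zero_le_one, fun e _ => (hw e).1⟩, (le_minWeight.1 le_rfl).1⟩

variable (a : Edge n → ℝ)

lemma measurable_forestExponent (hF : (graph F).IsAcyclic) :
    Measurable fun p : (Edge n → ℝ) × ℝ => forestExponent a F p.1 p.2 := by
  unfold forestExponent
  refine Finset.measurable_sum _ fun e _ => Measurable.const_mul ?_ _
  split_ifs
  · exact (measurable_weightMatrix hF).comp measurable_fst
  · exact measurable_snd

lemma abs_exp_forestExponent_le (hF : (graph F).IsAcyclic) {w : Edge n → ℝ}
    (hw : ∀ e, w e ∈ Set.Icc (0 : ℝ) 1) {t : ℝ} (ht : t ∈ Set.Icc (0 : ℝ) 1) :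
    ‖Real.exp (forestExponent a F w t)‖ ≤ Real.exp (∑ e, |a e|) := by
  rw [Real.norm_eq_abs, Real.abs_exp, Real.exp_le_exp, forestExponent]
  refine Finset.sum_le_sum fun e _ => (le_abs_self _).trans ?_
  rw [abs_mul]
  refine mul_le_of_le_one_right (abs_nonneg _) ?_
  split_ifs
  · have := weightMatrix_mem_Icc (i := e.1.1) (j := e.1.2) hF fun e _ => hw e
    rw [abs_of_nonneg this.1]
    exact this.2
  · rw [abs_of_nonneg ht.1]
    exact ht.2

open Classical in
-- The entries that `e` newly connects take the value `w e`, which is also the value of the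
-- parameter there. This lets the integrand for `F` at `t = w e` be read as one for `F ∪ {e}`.
lemma forestExponent_insert (hF : (graph F).IsAcyclic)
    (he : ¬ (graph F).Reachable e.1.1 e.1.2) {w : Edge n → ℝ} (hw : ∀ e' ∈ F, w e ≤ w e') :
    forestExponent a (insert e F) w (w e) = forestExponent a F w (w e) := by
  refine Finset.sum_congr rfl fun e' _ => ?_
  congr 1
  by_cases hr : (graph F).Reachable e'.1.1 e'.1.2
  · rw [if_pos hr, if_pos (hr.mono (graph_mono (Finset.subset_insert e F))),
      weightMatrix_insert_of_reachable hF he e'.2.ne hr hw]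
  · rw [if_neg hr]
    split_ifs with hr'
    · exact weightMatrix_insert_of_not_reachable hF he hr hr' hw
    · rfl

open Classical in
lemma forestExponent_update (he : e ∉ F) (w : Edge n → ℝ) (s t : ℝ) :
    forestExponent a F (Function.update w e s) t = forestExponent a F w t := by
  have : weightMatrix F (Function.update w e s) = weightMatrix F w := by
    rw [weightMatrix, weightMatrix]
    congr 1
    ext e'
    exact Function.update_of_ne (ne_of_mem_of_not_mem e'.2 he) _ _
  simp only [forestExponent, this]

open Classical in
lemma minWeight_update (he : e ∉ F) (w : Edge n → ℝ) (s : ℝ) :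
    minWeight F (Function.update w e s) = minWeight F w := by
  refine eq_of_forall_le_iff fun t => ?_
  rw [le_minWeight, le_minWeight]
  refine and_congr_right fun _ => forall₂_congr fun e' he' => ?_
  rw [Function.update_of_ne (ne_of_mem_of_not_mem he' he)]

open Classical in
/-- The edges joining different components of the forest. -/
noncomputable def joiningEdges (F : Finset (Edge n)) : Finset (Edge n) :=
  Finset.univ.filter fun e => ¬ (graph F).Reachable e.1.1 e.1.2

lemma mem_joiningEdges : e ∈ joiningEdges F ↔ ¬ (graph F).Reachable e.1.1 e.1.2 := by
  simp [joiningEdges]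

/-- The exponent is affine in `t`, and only joining edges contribute to its slope. -/
lemma hasDerivAt_exp_forestExponent (w : Edge n → ℝ) (t : ℝ) :
    HasDerivAt (fun t => Real.exp (forestExponent a F w t))
      ((∑ e ∈ joiningEdges F, a e) * Real.exp (forestExponent a F w t)) t := by
  classical
  rw [mul_comm]
  refine HasDerivAt.exp ?_
  rw [joiningEdges, Finset.sum_filter]
  unfold forestExponent
  refine HasDerivAt.fun_sum fun e _ => ?_
  by_cases h : (graph F).Reachable e.1.1 e.1.2
  · simpa [h] using hasDerivAt_const _ _
  · simpa [h] using (hasDerivAt_id t).const_mul (a e)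

/-- The exponential of the exponent, cut off at parameters below all the weights of the forest. -/
noncomputable def truncatedExp (a : Edge n → ℝ) (F : Finset (Edge n)) (p : (Edge n → ℝ) × ℝ) : ℝ :=
  (Set.Iic (minWeight F p.1)).indicator (fun t => Real.exp (forestExponent a F p.1 t)) p.2

/-- Newton's formula in the parameter joining different components. -/
lemma exp_forestExponent_sub {w : Edge n → ℝ} (hw : ∀ e, w e ∈ Set.Icc (0 : ℝ) 1) :
    Real.exp (forestExponent a F w (minWeight F w)) - Real.exp (forestExponent a F w 0) =
      (∑ e ∈ joiningEdges F, a e) * ∫ t in Set.Icc (0 : ℝ) 1, truncatedExp a F (w, t) := by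
  have hm := minWeight_mem_Icc (F := F) hw
  have hc : Continuous fun t => Real.exp (forestExponent a F w t) :=
    continuous_iff_continuousAt.2 fun t => (hasDerivAt_exp_forestExponent a w t).continuousAt
  rw [← intervalIntegral.integral_eq_sub_of_hasDerivAt
    (fun t _ => hasDerivAt_exp_forestExponent a w t)
    ((continuous_const.mul hc).intervalIntegrable _ _),
    intervalIntegral.integral_const_mul,
    intervalIntegral.integral_of_le hm.1, ← integral_Icc_eq_integral_Ioc]
  simp only [truncatedExp]
  rw [integral_indicator measurableSet_Iic, Measure.restrict_restrict measurableSet_Iic]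
  congr 3
  ext t
  simp only [Set.mem_Icc, Set.mem_inter_iff, Set.mem_Iic]
  exact ⟨fun h => ⟨h.2, h.1, h.2.trans hm.2⟩, fun h => ⟨h.2.1, h.1⟩⟩

lemma measurable_truncatedExp (hF : (graph F).IsAcyclic) : Measurable (truncatedExp a F) := by
  have : truncatedExp a F = {p : (Edge n → ℝ) × ℝ | p.2 ≤ minWeight F p.1}.indicator
      fun p => Real.exp (forestExponent a F p.1 p.2) := by
    ext p
    simp [truncatedExp, Set.indicator_apply]
  rw [this]
  exact (measurable_forestExponent a hF).exp.indicator
    (measurableSet_le measurable_snd (measurable_minWeight.comp measurable_fst))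

lemma norm_truncatedExp_le (hF : (graph F).IsAcyclic) {w : Edge n → ℝ}
    (hw : ∀ e, w e ∈ Set.Icc (0 : ℝ) 1) {t : ℝ} (ht : t ∈ Set.Icc (0 : ℝ) 1) :
    ‖truncatedExp a F (w, t)‖ ≤ Real.exp (∑ e, |a e|) :=
  (norm_indicator_le_norm_self _ _).trans (abs_exp_forestExponent_le a hF hw ht)

lemma integrable_truncatedExp (hF : (graph F).IsAcyclic) :
    Integrable (truncatedExp a F)
      ((cubeMeasure (Edge n)).prod (volume.restrict (Set.Icc (0 : ℝ) 1))) := by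
  refine Integrable.of_bound (measurable_truncatedExp a hF).aestronglyMeasurable
    (Real.exp (∑ e, |a e|)) ?_
  filter_upwards [Measure.quasiMeasurePreserving_fst.ae (ae_cubeMeasure_mem (ι := Edge n)),
    Measure.quasiMeasurePreserving_snd.ae (ae_restrict_mem measurableSet_Icc)] with p h1 h2
  exact norm_truncatedExp_le a hF h1 h2

/-- Applied with `m` equal to `minWeight F`, to 0, and to a single coordinate. -/
lemma integrable_exp_forestExponent (hF : (graph F).IsAcyclic) {m : (Edge n → ℝ) → ℝ}
    (hm : Measurable m) (hm' : ∀ w, (∀ e, w e ∈ Set.Icc (0 : ℝ) 1) → m w ∈ Set.Icc (0 : ℝ) 1) :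
    Integrable (fun w => Real.exp (forestExponent a F w (m w))) (cubeMeasure (Edge n)) := by
  refine Integrable.of_bound ((measurable_forestExponent a hF).comp
    (measurable_id.prodMk hm)).exp.aestronglyMeasurable (Real.exp (∑ e, |a e|)) ?_
  filter_upwards [ae_cubeMeasure_mem (ι := Edge n)] with w hw
  exact abs_exp_forestExponent_le a hF hw (hm' w hw)

open Classical in
/-- The contribution of the weights for which `e` is the edge of smallest weight of `F`. -/
noncomputable def minEdgeIntegrand (a : Edge n → ℝ) (F : Finset (Edge n)) (e : Edge n)
    (w : Edge n → ℝ) : ℝ :=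
  {w : Edge n → ℝ | w e ≤ minWeight (F.erase e) w}.indicator
    (fun w => Real.exp (forestExponent a F w (w e))) w

lemma measurable_minEdgeIntegrand (hF : (graph F).IsAcyclic) (e : Edge n) :
    Measurable (minEdgeIntegrand a F e) :=
  ((measurable_forestExponent a hF).comp
    (measurable_id.prodMk (measurable_pi_apply e))).exp.indicator
    (measurableSet_le (measurable_pi_apply e) measurable_minWeight)

lemma integrable_minEdgeIntegrand (hF : (graph F).IsAcyclic) (e : Edge n) :
    Integrable (minEdgeIntegrand a F e) (cubeMeasure (Edge n)) :=
  (integrable_exp_forestExponent a hF (measurable_pi_apply e) fun _ hw => hw e).indicator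
    (measurableSet_le (measurable_pi_apply e) measurable_minWeight)

open Classical in
-- Newton's parameter becomes the weight of `e`. Quantities attached to `F` do not read the
-- coordinate `e`, so it may be resampled as the independent variable `t`; the cutoff `t ≤ minWeight
-- F` says that `e` is lightest.
lemma integral_minEdgeIntegrand_insert (hF : (graph F).IsAcyclic)
    (he : ¬ (graph F).Reachable e.1.1 e.1.2) :
    ∫ w, minEdgeIntegrand a (insert e F) e w ∂cubeMeasure (Edge n) =
      ∫ p, truncatedExp a F p
        ∂((cubeMeasure (Edge n)).prod (volume.restrict (Set.Icc (0 : ℝ) 1))) := by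
  have heF : e ∉ F := fun h => he (reachable_of_mem h)
  have h0 := integral_map (μ := (cubeMeasure (Edge n)).prod (volume.restrict (Set.Icc (0 : ℝ) 1)))
    (measurePreserving_update e).measurable.aemeasurable
    (measurable_minEdgeIntegrand a (isAcyclic_insert hF he) e).aestronglyMeasurable
  rw [(measurePreserving_update e).map_eq] at h0
  rw [h0]
  refine integral_congr_ae (Filter.Eventually.of_forall fun p => ?_)
  simp only [minEdgeIntegrand, truncatedExp, Set.indicator_apply, Set.mem_ofPred_eq, Set.mem_Iic,
    Finset.erase_insert heF, minWeight_update heF, Function.update_self]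
  split_ifs with h
  · congr 1
    have h1 : ∀ e' ∈ F, Function.update p.1 e p.2 e ≤ Function.update p.1 e p.2 e' := by
      intro e' he'
      rw [Function.update_self, Function.update_of_ne (ne_of_mem_of_not_mem he' heF)]
      exact (le_minWeight.1 h).2 e' he'
    have h2 := forestExponent_insert a hF he h1
    rw [Function.update_self] at h2
    rw [h2, forestExponent_update a heF]
  · rfl

lemma integral_exp_forestExponent_sub (hF : (graph F).IsAcyclic) :
    ∫ w, Real.exp (forestExponent a F w (minWeight F w)) ∂cubeMeasure (Edge n) -
      ∫ w, Real.exp (forestExponent a F w 0) ∂cubeMeasure (Edge n) =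
      (∑ e ∈ joiningEdges F, a e) * ∫ p, truncatedExp a F p
        ∂((cubeMeasure (Edge n)).prod (volume.restrict (Set.Icc (0 : ℝ) 1))) := by
  rw [← integral_sub (integrable_exp_forestExponent a hF measurable_minWeight
    fun _ hw => minWeight_mem_Icc hw)
    (integrable_exp_forestExponent a hF measurable_const fun _ _ => ⟨le_rfl, zero_le_one⟩),
    integral_prod _ (integrable_truncatedExp a hF), ← integral_const_mul]
  refine integral_congr_ae ?_
  filter_upwards [ae_cubeMeasure_mem (ι := Edge n)] with w hw
  exact exp_forestExponent_sub a hw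

/-- Weights are almost surely distinct, so the events "`e` is lightest in `F`" partition the cube up
to a null set. -/
lemma integral_exp_forestExponent_minWeight (hF : (graph F).IsAcyclic) (hne : F.Nonempty) :
    ∫ w, Real.exp (forestExponent a F w (minWeight F w)) ∂cubeMeasure (Edge n) =
      ∑ e ∈ F, ∫ w, minEdgeIntegrand a F e w ∂cubeMeasure (Edge n) := by
  classical
  rw [← integral_finsetSum (f := minEdgeIntegrand a F) _ fun e _ =>
    integrable_minEdgeIntegrand a hF e]
  refine integral_congr_ae ?_
  filter_upwards [ae_cubeMeasure_mem (ι := Edge n), ae_cubeMeasure_injective (ι := Edge n)]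
    with w hw hinj
  obtain ⟨e, he, hmin⟩ := F.exists_min_image w hne
  have h1 : minWeight F w = w e :=
    le_antisymm ((le_minWeight.1 le_rfl).2 e he) (le_minWeight.2 ⟨(hw e).2, hmin⟩)
  rw [Finset.sum_eq_single_of_mem e he]
  · rw [minEdgeIntegrand, Set.indicator_of_mem, h1]
    exact le_minWeight.2 ⟨(hw e).2, fun e' he' => hmin e' (Finset.mem_of_mem_erase he')⟩
  · intro e' he' hne'
    rw [minEdgeIntegrand, Set.indicator_of_notMem]
    intro h
    have h2 := (le_minWeight.1 h).2 e (Finset.mem_erase.2 ⟨hne'.symm, he⟩)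
    exact hne' (hinj (le_antisymm h2 (hmin e' he')))

lemma mem_forests : F ∈ forests n ↔ (graph F).IsAcyclic := by
  simp [forests]

lemma graph_empty : graph (∅ : Finset (Edge n)) = ⊥ := by
  ext i j
  simp [graph_adj]

/-- The forest formula for the exponential of a linear function, with weights on all edges. -/
lemma exp_sum_eq_sum_forests_cube :
    Real.exp (∑ e, a e) = ∑ F ∈ forests n,
      (∏ e ∈ F, a e) * ∫ w, Real.exp (forestExponent a F w 0) ∂cubeMeasure (Edge n) := by
  classical
  set S : Finset (Edge n) → ℝ := fun F =>
    ∫ w, Real.exp (forestExponent a F w (minWeight F w)) ∂cubeMeasure (Edge n) with hS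
  set I : Finset (Edge n) → Edge n → ℝ := fun F e =>
    ∫ w, minEdgeIntegrand a F e w ∂cubeMeasure (Edge n) with hI
  have hempty : (∅ : Finset (Edge n)) ∈ forests n := by
    rw [mem_forests, graph_empty]
    exact SimpleGraph.isAcyclic_bot
  -- Averaged Newton formula: upper boundary term minus one term per joining edge.
  have h1 : ∀ F ∈ forests n,
      (∏ e ∈ F, a e) * ∫ w, Real.exp (forestExponent a F w 0) ∂cubeMeasure (Edge n) =
      (∏ e ∈ F, a e) * S F - ∑ e ∈ joiningEdges F, (∏ e ∈ insert e F, a e) * I (insert e F) e := by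
    intro F hF
    rw [mem_forests] at hF
    have h2 := integral_exp_forestExponent_sub a hF
    have h3 : ∑ e ∈ joiningEdges F, (∏ e ∈ insert e F, a e) * I (insert e F) e =
        (∏ e ∈ F, a e) * ((∑ e ∈ joiningEdges F, a e) * ∫ p, truncatedExp a F p
        ∂((cubeMeasure (Edge n)).prod (volume.restrict (Set.Icc (0 : ℝ) 1)))) := by
      rw [Finset.sum_mul, Finset.mul_sum]
      refine Finset.sum_congr rfl fun e he => ?_
      rw [mem_joiningEdges] at he
      rw [Finset.prod_insert fun h => he (reachable_of_mem h), hI]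
      simp only [integral_minEdgeIntegrand_insert a hF he]
      ring
    rw [h3, ← h2]
    ring
  -- Pairs (forest, joining edge) correspond to pairs (nonempty forest, one of its edges), by
  -- inserting or erasing the edge.
  have h4 : ∑ F ∈ forests n, ∑ e ∈ joiningEdges F, (∏ e ∈ insert e F, a e) * I (insert e F) e =
      ∑ F ∈ (forests n).erase ∅, (∏ e ∈ F, a e) * S F := by
    have h5 : ∀ F ∈ (forests n).erase ∅, (∏ e ∈ F, a e) * S F =
        ∑ e ∈ F, (∏ e ∈ F, a e) * I F e := by
      intro F hF
      rw [Finset.mem_erase, mem_forests] at hF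
      rw [← Finset.mul_sum, hS, hI]
      simp only [integral_exp_forestExponent_minWeight a hF.2
        (Finset.nonempty_iff_ne_empty.2 hF.1)]
    rw [Finset.sum_congr rfl h5, Finset.sum_sigma', Finset.sum_sigma']
    refine Finset.sum_bij' (fun p _ => ⟨insert p.2 p.1, p.2⟩) (fun p _ => ⟨p.1.erase p.2, p.2⟩)
      ?_ ?_ ?_ ?_ ?_
    · rintro ⟨F, e⟩ h
      simp only [Finset.mem_sigma, mem_forests, mem_joiningEdges, Finset.mem_erase] at h ⊢
      exact ⟨⟨Finset.insert_ne_empty _ _, isAcyclic_insert h.1 h.2⟩, Finset.mem_insert_self _ _⟩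
    · rintro ⟨F, e⟩ h
      simp only [Finset.mem_sigma, mem_forests, mem_joiningEdges, Finset.mem_erase] at h ⊢
      refine ⟨h.1.2.anti (graph_mono (Finset.erase_subset _ _)),
        not_reachable_of_isAcyclic_insert (Finset.notMem_erase _ _) ?_⟩
      rw [Finset.insert_erase h.2]
      exact h.1.2
    · rintro ⟨F, e⟩ h
      simp only [Finset.mem_sigma, mem_joiningEdges] at h
      simp [Finset.erase_insert fun h' => h.2 (reachable_of_mem h')]
    · rintro ⟨F, e⟩ h
      simp only [Finset.mem_sigma] at h
      simp [Finset.insert_erase h.2]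
    · rintro ⟨F, e⟩ h
      rfl
  rw [Finset.sum_congr rfl h1, Finset.sum_sub_distrib, h4,
    ← Finset.add_sum_erase _ _ hempty, add_sub_cancel_right, Finset.prod_empty, one_mul, hS]
  -- Here the default value 1 of `minWeight ∅` sets every off-diagonal entry to 1.
  have h6 : ∀ w, forestExponent a ∅ w (minWeight ∅ w) = ∑ e, a e := by
    intro w
    simp only [forestExponent, graph_empty, SimpleGraph.reachable_bot]
    refine Finset.sum_congr rfl fun e _ => ?_
    rw [if_neg e.2.ne]
    simp [minWeight]
  simp [h6]

/-- The forest formula for the exponential of a linear function. -/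
theorem exp_sum_eq_sum_forests :
    Real.exp (∑ e, a e) = ∑ F ∈ forests n, (∏ e ∈ F, a e) *
      ∫ w in unitCube F, Real.exp (∑ e, a e * forestMatrix F w e.1.1 e.1.2) := by
  rw [exp_sum_eq_sum_forests_cube]
  refine Finset.sum_congr rfl fun F hF => ?_
  rw [mem_forests] at hF
  have hm : Measurable fun w : F → ℝ => Real.exp (∑ e, a e * forestMatrix F w e.1.1 e.1.2) :=
    (Finset.measurable_sum _ fun e _ => (measurable_forestMatrix hF).const_mul _).exp
  rw [unitCube, ← cubeMeasure_eq_restrict, ← (measurePreserving_restrict_cube F).map_eq,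
    integral_map (measurePreserving_restrict_cube F).measurable.aemeasurable
      hm.aestronglyMeasurable]
  congr 2
  ext w
  congr 1
  refine Finset.sum_congr rfl fun e _ => ?_
  congr 1
  split_ifs with h
  · rfl
  · exact (weightMatrix_of_not_reachable h w).symm

end ForestFormula

end ReplicaForest

namespace ReplicaForest

open scoped FourierTransform SchwartzMap InnerProductSpace

/-! ### Fourier representation and the formula for Schwartz functions -/

section Fourier

/-- The integral of a Schwartz function against a probability measure, in terms of the Fourier
transform and the characteristic function. -/
lemma integral_schwartz_eq_integral_charFun {V : Type*} [NormedAddCommGroup V]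
    [InnerProductSpace ℝ V] [FiniteDimensional ℝ V] [MeasurableSpace V] [BorelSpace V]
    (H : 𝓢(V, ℂ)) (ν : Measure V) [IsProbabilityMeasure ν] :
    ∫ x, H x ∂ν = ∫ ξ, 𝓕 H ξ * charFun ν ((2 * Real.pi) • ξ) := by
  have h1 : ∀ x, H x = ∫ ξ, Complex.exp (↑(2 * Real.pi * ⟪ξ, x⟫_ℝ) * Complex.I) • 𝓕 H ξ := by
    intro x
    have h := congrArg (fun f : 𝓢(V, ℂ) => f x)
      (FourierTransform.fourierInv_fourier_eq (F := 𝓢(V, ℂ)) H)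
    simp only [SchwartzMap.fourierInv_coe] at h
    rw [← h, Real.fourierInv_eq']
  simp only [h1]
  rw [integral_integral_swap]
  · refine integral_congr_ae (Filter.Eventually.of_forall fun ξ => ?_)
    simp only [charFun_apply, smul_eq_mul]
    rw [integral_mul_const, mul_comm]
    congr 1
    refine integral_congr_ae (Filter.Eventually.of_forall fun x => ?_)
    simp only [inner_smul_right, real_inner_comm x ξ]
  · refine Integrable.mono' ((𝓕 H).integrable.norm.comp_snd ν) ?_ ?_
    · refine Continuous.aestronglyMeasurable ?_
      have := (𝓕 H).continuous
      simp only [Function.uncurry_def]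
      fun_prop
    · refine Filter.Eventually.of_forall fun p => ?_
      simp only [Function.uncurry_def, norm_smul, Complex.norm_exp_ofReal_mul_I, one_mul]
      exact le_rfl

lemma charFun_map_eq {V W : Type*} [NormedAddCommGroup V] [InnerProductSpace ℝ V]
    [MeasurableSpace V] [BorelSpace V] [NormedAddCommGroup W]
    [InnerProductSpace ℝ W] [MeasurableSpace W] [BorelSpace W] [SecondCountableTopology W]
    {μ : Measure V} {L : V → W} (hL : Measurable L) {ξ : W} {η : V}
    (h : ∀ x, ⟪L x, ξ⟫_ℝ = ⟪x, η⟫_ℝ) : charFun (μ.map L) ξ = charFun μ η := by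
  rw [charFun_apply, integral_map hL.aemeasurable (by fun_prop), charFun_apply]
  simp only [h]

variable {N n : ℕ} (C : Matrix (Fin N) (Fin N) ℝ)

/-- The quadratic form `∑ C_{pq} ξ_{p,i} ξ_{q,j}`. -/
noncomputable def replicaForm (ξ : EuclideanSpace ℝ (Fin N × Fin n)) (i j : Fin n) : ℝ :=
  ∑ p, ∑ q, C p q * (ξ (p, i) * ξ (q, j))

/-- The Fourier symbol of the edge operator. -/
noncomputable def edgeSymbol (ξ : EuclideanSpace ℝ (Fin N × Fin n)) (ℓ : Edge n) : ℝ :=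
  -(2 * Real.pi) ^ 2 * replicaForm C ξ ℓ.1.1 ℓ.1.2

variable {C}

lemma replicaForm_symm (hC : C.PosSemidef) (ξ : EuclideanSpace ℝ (Fin N × Fin n)) (i j : Fin n) :
    replicaForm C ξ i j = replicaForm C ξ j i := by
  rw [replicaForm, replicaForm, Finset.sum_comm]
  refine Finset.sum_congr rfl fun p _ => Finset.sum_congr rfl fun q _ => ?_
  have := hC.isHermitian.apply p q
  rw [star_trivial] at this
  rw [this]
  ring

lemma continuous_replicaForm (i j : Fin n) :
    Continuous fun ξ : EuclideanSpace ℝ (Fin N × Fin n) => replicaForm C ξ i j := by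
  unfold replicaForm
  fun_prop

lemma dotProduct_kronecker_mulVec (X : Matrix (Fin n) (Fin n) ℝ)
    (ξ : EuclideanSpace ℝ (Fin N × Fin n)) :
    ξ.ofLp ⬝ᵥ (C ⊗ₖ X).mulVec ξ.ofLp = ∑ i, ∑ j, X i j * replicaForm C ξ i j := by
  simp only [dotProduct, Matrix.mulVec, Matrix.kroneckerMap_apply, Fintype.sum_prod_type,
    replicaForm, Finset.mul_sum]
  rw [Finset.sum_comm]
  refine Finset.sum_congr rfl fun i _ => ?_
  conv_rhs => rw [Finset.sum_comm]
  refine Finset.sum_congr rfl fun p _ => ?_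
  rw [Finset.sum_comm]
  refine Finset.sum_congr rfl fun j _ => Finset.sum_congr rfl fun q _ => ?_
  ring

lemma sum_sum_eq_sum_diag_add_sum_edge {g : Fin n → Fin n → ℝ} (hg : ∀ i j, g i j = g j i) :
    ∑ i, ∑ j, g i j = ∑ i, g i i + 2 * ∑ ℓ : Edge n, g ℓ.1.1 ℓ.1.2 := by
  have h1 : ∀ i j, g i j = (if i = j then g i j else 0) + ((if i < j then g i j else 0) +
      (if j < i then g i j else 0)) := by
    intro i j
    rcases lt_trichotomy i j with h | h | h
    · simp [h, h.ne, h.not_gt]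
    · simp [h]
    · simp [h, h.ne', h.not_gt]
  have h2 : ∑ ℓ : Edge n, g ℓ.1.1 ℓ.1.2 = ∑ i, ∑ j, if i < j then g i j else 0 := by
    rw [← Fintype.sum_prod_type' (f := fun i j => if i < j then g i j else 0),
      ← Finset.sum_filter]
    exact (Finset.sum_subtype (p := fun e : Fin n × Fin n => e.1 < e.2) _ (by simp)
      (fun e => g e.1 e.2)).symm
  have h3 : ∑ i, ∑ j, (if j < i then g i j else 0) = ∑ i, ∑ j, if i < j then g i j else 0 := by
    rw [Finset.sum_comm]
    simp only [hg]
  rw [h2]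
  conv_lhs =>
    enter [2, i, 2, j]
    rw [h1]
  simp only [Finset.sum_add_distrib, h3]
  simp
  ring

/-- The unit diagonal gives a part independent of `X`. Each edge is counted twice in the double sum,
which cancels the `1/2`. -/
lemma quadratic_eq_edgeSymbol (hC : C.PosSemidef) {X : Matrix (Fin n) (Fin n) ℝ}
    (hX : ∀ i j, X i j = X j i) (hX1 : ∀ i, X i i = 1) (ξ : EuclideanSpace ℝ (Fin N × Fin n)) :
    -(2 * Real.pi) ^ 2 * ∑ i, ∑ j, X i j * replicaForm C ξ i j / 2 =
      -(2 * Real.pi) ^ 2 * ∑ i, replicaForm C ξ i i / 2 +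
        ∑ ℓ : Edge n, edgeSymbol C ξ ℓ * X ℓ.1.1 ℓ.1.2 := by
  rw [sum_sum_eq_sum_diag_add_sum_edge (g := fun i j => X i j * replicaForm C ξ i j / 2)
    fun i j => by rw [hX, replicaForm_symm hC]]
  simp only [hX1, one_mul, mul_add, Finset.mul_sum, edgeSymbol]
  congr 1
  refine Finset.sum_congr rfl fun ℓ _ => ?_
  ring

instance (ι : Type*) [Fintype ι] [DecidableEq ι] (S : Matrix ι ι ℝ) :
    IsProbabilityMeasure (gaussian S) := by
  unfold gaussian
  infer_instance

lemma charFun_gaussian {ι : Type*} [Fintype ι] [DecidableEq ι] {S : Matrix ι ι ℝ}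
    (hS : S.PosSemidef) (ξ : EuclideanSpace ℝ ι) :
    charFun (gaussian S) ξ = (Real.exp (-(ξ.ofLp ⬝ᵥ S.mulVec ξ.ofLp / 2)) : ℂ) := by
  rw [gaussian, charFun_multivariateGaussian hS]
  push_cast
  simp

lemma charFun_gaussian_kronecker (hC : C.PosSemidef) {X : Matrix (Fin n) (Fin n) ℝ}
    (hX : X.PosSemidef) (hX1 : ∀ i, X i i = 1) (ξ : EuclideanSpace ℝ (Fin N × Fin n)) :
    charFun (gaussian (C ⊗ₖ X)) ((2 * Real.pi) • ξ) =
      (Real.exp (-(2 * Real.pi) ^ 2 * ∑ i, replicaForm C ξ i i / 2 +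
        ∑ ℓ : Edge n, edgeSymbol C ξ ℓ * X ℓ.1.1 ℓ.1.2) : ℂ) := by
  rw [charFun_gaussian (hC.kronecker hX), ← quadratic_eq_edgeSymbol hC _ hX1]
  · rw [WithLp.ofLp_smul, Matrix.mulVec_smul, smul_dotProduct, dotProduct_smul,
      dotProduct_kronecker_mulVec]
    simp only [← Finset.sum_div, smul_eq_mul]
    congr 3
    ring
  · intro i j
    have := hX.isHermitian.apply i j
    rw [star_trivial] at this
    exact this.symm

/-- All the replicas equal to `τ`. -/
def diagonal (n : ℕ) (τ : EuclideanSpace ℝ (Fin N)) : EuclideanSpace ℝ (Fin N × Fin n) :=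
  WithLp.toLp 2 fun a => τ a.1

lemma continuous_diagonal : Continuous (diagonal (N := N) n) := by
  unfold diagonal
  fun_prop

/-- Identical replicas form the degenerate case in which every entry of `X` is 1. -/
lemma charFun_map_diagonal (hC : C.PosSemidef) (ξ : EuclideanSpace ℝ (Fin N × Fin n)) :
    charFun ((gaussian C).map (diagonal n)) ((2 * Real.pi) • ξ) =
      (Real.exp (-(2 * Real.pi) ^ 2 * ∑ i, replicaForm C ξ i i / 2 +
        ∑ ℓ : Edge n, edgeSymbol C ξ ℓ) : ℂ) := by
  rw [charFun_map_eq (η := (2 * Real.pi) • WithLp.toLp 2 fun p => ∑ i, ξ (p, i))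
    continuous_diagonal.measurable, charFun_gaussian hC]
  · have := quadratic_eq_edgeSymbol hC (X := fun _ _ => 1) (by simp) (by simp) ξ
    simp only [one_mul, mul_one] at this
    rw [← this]
    rw [WithLp.ofLp_smul, Matrix.mulVec_smul, smul_dotProduct, dotProduct_smul]
    have h1 : (fun p => ∑ i, ξ (p, i)) ⬝ᵥ C.mulVec (fun p => ∑ i, ξ (p, i)) =
        ∑ i, ∑ j, replicaForm C ξ i j := by
      have h2 : ∀ p q, (∑ i, ξ (p, i)) * (C p q * ∑ j, ξ (q, j)) =
          ∑ i, ∑ j, C p q * (ξ (p, i) * ξ (q, j)) := by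
        intro p q
        rw [mul_left_comm, Finset.sum_mul_sum]
        simp only [Finset.mul_sum]
      simp only [dotProduct, Matrix.mulVec, replicaForm]
      conv_lhs =>
        enter [2, p]
        rw [Finset.mul_sum]
        simp only [h2]
        rw [Finset.sum_comm]
        enter [2, i]
        rw [Finset.sum_comm]
      rw [Finset.sum_comm]
      refine Finset.sum_congr rfl fun i _ => ?_
      rw [Finset.sum_comm]
    rw [h1]
    simp only [← Finset.sum_div, smul_eq_mul]
    congr 3
    ring
  · intro τ
    simp only [diagonal, PiLp.inner_apply, Fintype.sum_prod_type, PiLp.smul_apply,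
      RCLike.inner_apply, conj_trivial, smul_eq_mul, Finset.mul_sum, Finset.sum_mul]

/-- Each partial derivative becomes multiplication by `2πi` times a coordinate; two of them give the
factor `-(2π)²` in `edgeSymbol`. -/
lemma exists_schwartz_edgeOp (ℓ : Edge n) (G : 𝓢(EuclideanSpace ℝ (Fin N × Fin n), ℂ)) :
    ∃ G' : 𝓢(EuclideanSpace ℝ (Fin N × Fin n), ℂ), ⇑G' = edgeOp C ℓ ⇑G ∧
      ∀ ξ, 𝓕 G' ξ = (edgeSymbol C ξ ℓ : ℂ) * 𝓕 G ξ := by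
  have h1 : ∀ (m : EuclideanSpace ℝ (Fin N × Fin n))
      (H : 𝓢(EuclideanSpace ℝ (Fin N × Fin n), ℂ)) ξ, 𝓕 (LineDeriv.lineDerivOp m H) ξ =
        2 * Real.pi * Complex.I * ⟪ξ, m⟫_ℝ * 𝓕 H ξ := by
    intro m H ξ
    have : (fun x => ⟪x, m⟫_ℝ).HasTemperateGrowth := ((innerSL ℝ).flip m).hasTemperateGrowth
    rw [SchwartzMap.fourier_lineDerivOp_eq, smul_apply,
      SchwartzMap.smulLeftCLM_apply_apply this, smul_eq_mul, Complex.real_smul]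
    ring
  refine ⟨∑ p, ∑ q, C p q • LineDeriv.lineDerivOp (EuclideanSpace.single (p, ℓ.1.1) (1 : ℝ))
    (LineDeriv.lineDerivOp (EuclideanSpace.single (q, ℓ.1.2) (1 : ℝ)) G), ?_, fun ξ => ?_⟩
  · ext τ
    have h3 : ∀ (a : Fin N × Fin n) (H : 𝓢(EuclideanSpace ℝ (Fin N × Fin n), ℂ)),
        ⇑(LineDeriv.lineDerivOp (EuclideanSpace.single a (1 : ℝ)) H) = partialDeriv a ⇑H := by
      intro a H
      ext τ
      rw [SchwartzMap.lineDerivOp_apply, partialDeriv]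
    simp only [sum_apply, smul_apply, edgeOp, h3]
  · have h2 : 𝓕 (∑ p, ∑ q, C p q • LineDeriv.lineDerivOp
        (EuclideanSpace.single (p, ℓ.1.1) (1 : ℝ)) (LineDeriv.lineDerivOp
          (EuclideanSpace.single (q, ℓ.1.2) (1 : ℝ)) G)) =
        ∑ p, ∑ q, C p q • 𝓕 (LineDeriv.lineDerivOp
        (EuclideanSpace.single (p, ℓ.1.1) (1 : ℝ)) (LineDeriv.lineDerivOp
          (EuclideanSpace.single (q, ℓ.1.2) (1 : ℝ)) G)) := by
      simp only [← SchwartzMap.fourierTransformCLM_apply ℂ, map_sum]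
      refine Finset.sum_congr rfl fun p _ => Finset.sum_congr rfl fun q _ => ?_
      exact ((SchwartzMap.fourierTransformCLM ℂ).restrictScalars ℝ).map_smul _ _
    rw [h2]
    simp only [sum_apply, smul_apply, h1, edgeSymbol, replicaForm]
    push_cast
    rw [Finset.mul_sum, Finset.sum_mul]
    refine Finset.sum_congr rfl fun p _ => ?_
    rw [Finset.mul_sum, Finset.sum_mul]
    refine Finset.sum_congr rfl fun q _ => ?_
    rw [Complex.real_smul]
    simp only [EuclideanSpace.inner_single_right, one_mul, conj_trivial]
    linear_combination (4 * (C p q : ℂ) * Real.pi ^ 2 * ξ (p, ℓ.1.1) * ξ (q, ℓ.1.2) * 𝓕 G ξ) *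
      Complex.I_sq

lemma exists_schwartz_forestOp (F : Finset (Edge n))
    (G : 𝓢(EuclideanSpace ℝ (Fin N × Fin n), ℂ)) :
    ∃ G' : 𝓢(EuclideanSpace ℝ (Fin N × Fin n), ℂ), ⇑G' = forestOp C F ⇑G ∧
      ∀ ξ, 𝓕 G' ξ = ((∏ ℓ ∈ F, edgeSymbol C ξ ℓ : ℝ) : ℂ) * 𝓕 G ξ := by
  have h : ∀ L : List (Edge n), ∃ G' : 𝓢(EuclideanSpace ℝ (Fin N × Fin n), ℂ),
      ⇑G' = L.foldr (edgeOp C) ⇑G ∧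
      ∀ ξ, 𝓕 G' ξ = (((L.map fun ℓ => edgeSymbol C ξ ℓ).prod : ℝ) : ℂ) * 𝓕 G ξ := by
    intro L
    induction L with
    | nil => exact ⟨G, rfl, fun ξ => by simp⟩
    | cons ℓ L ih =>
      obtain ⟨G₁, h1, h2⟩ := ih
      obtain ⟨G₂, h3, h4⟩ := exists_schwartz_edgeOp (C := C) ℓ G₁
      refine ⟨G₂, by rw [h3, h1, List.foldr_cons], fun ξ => ?_⟩
      rw [h4, h2, List.map_cons, List.prod_cons]
      push_cast
      ring
  obtain ⟨G', h1, h2⟩ := h F.toList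
  exact ⟨G', h1, fun ξ => by rw [h2, Finset.prod_map_toList]⟩

/-- The integrand of the forest formula on the Fourier side. -/
noncomputable def fourierIntegrand (C : Matrix (Fin N) (Fin N) ℝ)
    (G : 𝓢(EuclideanSpace ℝ (Fin N × Fin n), ℂ)) (F : Finset (Edge n)) (w : F → ℝ)
    (ξ : EuclideanSpace ℝ (Fin N × Fin n)) : ℂ :=
  ((∏ ℓ ∈ F, edgeSymbol C ξ ℓ : ℝ) : ℂ) * 𝓕 G ξ *
    (Real.exp (-(2 * Real.pi) ^ 2 * ∑ i, replicaForm C ξ i i / 2 +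
        ∑ ℓ : Edge n, edgeSymbol C ξ ℓ * forestMatrix F w ℓ.1.1 ℓ.1.2) : ℂ)

variable {F : Finset (Edge n)} (G : 𝓢(EuclideanSpace ℝ (Fin N × Fin n), ℂ))

lemma integral_forestOp_schwartz (hC : C.PosSemidef) (hF : (graph F).IsAcyclic) {w : F → ℝ}
    (hw : w ∈ unitCube F) :
    ∫ τ, forestOp C F ⇑G τ ∂gaussian (C ⊗ₖ forestMatrix F w) = ∫ ξ, fourierIntegrand C G F w ξ := by
  obtain ⟨G', h1, h2⟩ := exists_schwartz_forestOp (C := C) F G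
  rw [← h1, integral_schwartz_eq_integral_charFun]
  refine integral_congr_ae (Filter.Eventually.of_forall fun ξ => ?_)
  simp only [h2, fourierIntegrand]
  rw [charFun_gaussian_kronecker hC (posSemidef_forestMatrix hF hw) fun i => forestMatrix_self w]

lemma measurableSet_unitCube : MeasurableSet (unitCube F) :=
  MeasurableSet.univ_pi fun _ => measurableSet_Icc

instance : IsProbabilityMeasure (volume.restrict (unitCube F)) := by
  rw [unitCube, ← cubeMeasure_eq_restrict]
  infer_instance

lemma continuous_edgeSymbol (ℓ : Edge n) :
    Continuous fun ξ : EuclideanSpace ℝ (Fin N × Fin n) => edgeSymbol C ξ ℓ := by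
  unfold edgeSymbol
  exact continuous_const.mul (continuous_replicaForm _ _)

/-- The symbols are absorbed into the Fourier transform of the Schwartz function `forestOp C F G`,
and the remaining factor is a characteristic function, of modulus at most 1. -/
lemma integrable_fourierIntegrand (hC : C.PosSemidef) (hF : (graph F).IsAcyclic) :
    Integrable (Function.uncurry (fourierIntegrand C G F))
      ((volume.restrict (unitCube F)).prod volume) := by
  obtain ⟨G', -, h2⟩ := exists_schwartz_forestOp (C := C) F G
  refine Integrable.mono' ((𝓕 G').integrable.norm.comp_snd (volume.restrict (unitCube F))) ?_ ?_
  · refine Measurable.aestronglyMeasurable ?_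
    simp only [Function.uncurry_def, fourierIntegrand, ← h2]
    refine ((𝓕 G').continuous.measurable.comp measurable_snd).mul
      (Complex.measurable_ofReal.comp (Real.measurable_exp.comp (Measurable.add ?_ ?_)))
    · refine Continuous.measurable ?_
      have := fun i => (continuous_replicaForm (C := C) i i).comp
        (continuous_snd (X := F → ℝ) (Y := EuclideanSpace ℝ (Fin N × Fin n)))
      exact continuous_const.mul (continuous_finsetSum _ fun i _ => (this i).div_const 2)
    · refine Finset.measurable_sum _ fun ℓ _ => Measurable.mul ?_ ?_
      · exact (continuous_edgeSymbol ℓ).measurable.comp measurable_snd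
      · exact (measurable_forestMatrix hF).comp measurable_fst
  · filter_upwards [Measure.quasiMeasurePreserving_fst.ae
      (ae_restrict_mem (measurableSet_unitCube (F := F)))] with p hp
    simp only [Function.uncurry_def, fourierIntegrand, ← h2]
    rw [← charFun_gaussian_kronecker hC (posSemidef_forestMatrix hF hp)
      fun i => forestMatrix_self p.1, norm_mul]
    exact mul_le_of_le_one_right (norm_nonneg _) (norm_charFun_le_one _)

/-- On the Fourier side `w` enters an explicit integrand over a fixed measure, so Fubini gives
measurability in `w`. -/
lemma aestronglyMeasurable_integral_forestOp_schwartz (hC : C.PosSemidef)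
    (hF : (graph F).IsAcyclic) :
    AEStronglyMeasurable (fun w => ∫ τ, forestOp C F ⇑G τ ∂gaussian (C ⊗ₖ forestMatrix F w))
      (volume.restrict (unitCube F)) := by
  refine (integrable_fourierIntegrand G hC hF).integral_prod_left.aestronglyMeasurable.congr ?_
  filter_upwards [ae_restrict_mem (measurableSet_unitCube (F := F))] with w hw
  exact (integral_forestOp_schwartz G hC hF hw).symm

/-- The forest formula for Schwartz functions. -/
theorem integral_diagonal_schwartz (hC : C.PosSemidef) :
    ∫ τ, G (diagonal n τ) ∂gaussian C = ∑ F ∈ forests n, ∫ w in unitCube F,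
      ∫ τ, forestOp C F ⇑G τ ∂gaussian (C ⊗ₖ forestMatrix F w) := by
  have : IsProbabilityMeasure ((gaussian C).map (diagonal n)) :=
    Measure.isProbabilityMeasure_map continuous_diagonal.aemeasurable
  rw [← integral_map continuous_diagonal.aemeasurable
    G.continuous.aestronglyMeasurable, integral_schwartz_eq_integral_charFun]
  have h1 : ∀ F ∈ forests n, ∫ w in unitCube F,
      ∫ τ, forestOp C F ⇑G τ ∂gaussian (C ⊗ₖ forestMatrix F w) =
      ∫ ξ, ∫ w in unitCube F, fourierIntegrand C G F w ξ := by
    intro F hF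
    rw [mem_forests] at hF
    rw [← integral_integral_swap (integrable_fourierIntegrand G hC hF)]
    exact setIntegral_congr_fun measurableSet_unitCube
      fun w hw => integral_forestOp_schwartz G hC hF hw
  have h2 : ∀ F ∈ forests n, Integrable fun ξ => ∫ w in unitCube F, fourierIntegrand C G F w ξ :=
    fun F hF => (integrable_fourierIntegrand G hC (mem_forests.1 hF)).integral_prod_right
  rw [Finset.sum_congr rfl h1, ← integral_finsetSum _ h2]
  refine integral_congr_ae (Filter.Eventually.of_forall fun ξ => ?_)
  beta_reduce
  -- For fixed `ξ` the claim is the exponential forest formula with `a` equal to `edgeSymbol C ξ`.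
  rw [charFun_map_diagonal hC, Real.exp_add, exp_sum_eq_sum_forests]
  push_cast
  rw [Finset.mul_sum, Finset.mul_sum]
  refine Finset.sum_congr rfl fun F _ => ?_
  have h2 : ∀ w, fourierIntegrand C G F w ξ = (((∏ ℓ ∈ F, edgeSymbol C ξ ℓ : ℝ) : ℂ) * 𝓕 G ξ *
      (Real.exp (-(2 * Real.pi) ^ 2 * ∑ i, replicaForm C ξ i i / 2) : ℂ)) *
      (Real.exp (∑ ℓ : Edge n, edgeSymbol C ξ ℓ * forestMatrix F w ℓ.1.1 ℓ.1.2) : ℝ) := by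
    intro w
    rw [fourierIntegrand, Real.exp_add]
    push_cast
    ring
  simp only [h2]
  rw [integral_const_mul, integral_complex_ofReal]
  push_cast
  ring

end Fourier

end ReplicaForest

namespace ReplicaForest

/-! ### The forest operator on products of functions of single replicas -/

section Products

variable {𝕜 : Type*} [RCLike 𝕜] {N n : ℕ}

/-- The iterated partial derivative in the directions listed in `D`. -/
noncomputable def iterPartial (D : List (Fin N)) (g : EuclideanSpace ℝ (Fin N) → 𝕜) :
    EuclideanSpace ℝ (Fin N) → 𝕜 :=
  D.foldr (fun p h τ => lineDeriv ℝ h τ (EuclideanSpace.single p 1)) g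

lemma iterPartial_eq_iteratedFDeriv {g : EuclideanSpace ℝ (Fin N) → 𝕜} (hg : ContDiff ℝ ∞ g)
    (D : List (Fin N)) (τ : EuclideanSpace ℝ (Fin N)) :
    iterPartial D g τ =
      iteratedFDeriv ℝ D.length g τ fun k => EuclideanSpace.single (D.get k) 1 := by
  induction D generalizing τ with
  | nil => simp [iterPartial]
  | cons p D ih =>
    have h1 : iterPartial (p :: D) g τ =
        lineDeriv ℝ (iterPartial D g) τ (EuclideanSpace.single p 1) := rfl
    have hd : DifferentiableAt ℝ (iteratedFDeriv ℝ D.length g) τ :=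
      (hg.differentiable_iteratedFDeriv (by exact_mod_cast WithTop.coe_lt_top _)) τ
    rw [h1, funext ih]
    refine Eq.trans ?_ (iteratedFDeriv_succ_apply_left _).symm
    have h2 := (hd.hasFDerivAt.continuousMultilinear_apply_const
      fun k => EuclideanSpace.single (D.get k) (1 : ℝ))
    rw [(h2.differentiableAt).lineDeriv_eq_fderiv, h2.fderiv]
    rfl

lemma norm_iterPartial_le {g : EuclideanSpace ℝ (Fin N) → 𝕜} (hg : ContDiff ℝ ∞ g)
    (D : List (Fin N)) (τ : EuclideanSpace ℝ (Fin N)) :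
    ‖iterPartial D g τ‖ ≤ ‖iteratedFDeriv ℝ D.length g τ‖ := by
  rw [iterPartial_eq_iteratedFDeriv hg]
  refine (ContinuousMultilinearMap.le_opNorm _ _).trans (le_of_eq ?_)
  simp

lemma contDiff_iterPartial {g : EuclideanSpace ℝ (Fin N) → 𝕜} (hg : ContDiff ℝ ∞ g)
    (D : List (Fin N)) : ContDiff ℝ ∞ (iterPartial D g) := by
  induction D with
  | nil => exact hg
  | cons p D ih =>
    have h1 : iterPartial (p :: D) g =
        fun τ => fderiv ℝ (iterPartial D g) τ (EuclideanSpace.single p 1) := by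
      ext τ
      exact ((ih.differentiable (by simp)) τ).lineDeriv_eq_fderiv
    rw [h1]
    exact (ih.fderiv_right (m := ∞) (by simp)).clm_apply contDiff_const

/-- A product over the replicas of partial derivatives of the factors. -/
noncomputable def prodPartial (f : Fin n → EuclideanSpace ℝ (Fin N) → 𝕜)
    (D : Fin n → List (Fin N)) : EuclideanSpace ℝ (Fin N × Fin n) → 𝕜 :=
  fun τ => ∏ i, iterPartial (D i) (f i) (replica τ i)

lemma contDiff_replica (i : Fin n) :
    ContDiff ℝ ∞ fun τ : EuclideanSpace ℝ (Fin N × Fin n) => replica τ i := by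
  unfold replica
  fun_prop

lemma contDiff_prodPartial {f : Fin n → EuclideanSpace ℝ (Fin N) → 𝕜}
    (hf : ∀ i, ContDiff ℝ ∞ (f i)) (D : Fin n → List (Fin N)) :
    ContDiff ℝ ∞ (prodPartial f D) :=
  contDiff_prod fun i _ => (contDiff_iterPartial (hf i) (D i)).comp (contDiff_replica i)

/-- Along the direction `(p, i)` only the `i`-th factor varies. The others are constants in a field,
so no differentiability is needed. -/
lemma partialDeriv_prodPartial (f : Fin n → EuclideanSpace ℝ (Fin N) → 𝕜)
    (D : Fin n → List (Fin N)) (p : Fin N) (i : Fin n) :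
    partialDeriv (p, i) (prodPartial f D) = prodPartial f (Function.update D i (p :: D i)) := by
  ext τ
  have h1 : ∀ t : ℝ, prodPartial f D (τ + t • EuclideanSpace.single (p, i) 1) =
      (∏ j ∈ Finset.univ.erase i, iterPartial (D j) (f j) (replica τ j)) *
        iterPartial (D i) (f i) (replica τ i + t • EuclideanSpace.single p 1) := by
    intro t
    rw [prodPartial, ← Finset.prod_erase_mul _ _ (Finset.mem_univ i)]
    congr 1
    · refine Finset.prod_congr rfl fun j hj => ?_
      congr 1
      ext q
      simp [replica, Finset.ne_of_mem_erase hj]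
    · congr 1
      ext q
      by_cases hq : q = p <;> simp [replica, hq]
  rw [partialDeriv, lineDeriv]
  simp only [h1]
  rw [deriv_const_mul_field, prodPartial, ← Finset.prod_erase_mul _ _ (Finset.mem_univ i)]
  congr 1
  · refine Finset.prod_congr rfl fun j hj => ?_
    rw [Function.update_of_ne (Finset.ne_of_mem_erase hj)]
  · rw [Function.update_self]
    rfl

lemma partialDeriv_sum {ι : Type*} [Fintype ι] (a : Fin N × Fin n) (c : ι → ℝ)
    {g : ι → EuclideanSpace ℝ (Fin N × Fin n) → 𝕜} (hg : ∀ α, ContDiff ℝ ∞ (g α)) :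
    partialDeriv a (fun τ => ∑ α, c α • g α τ) = fun τ => ∑ α, c α • partialDeriv a (g α) τ := by
  ext τ
  have h : ∀ α, HasLineDerivAt ℝ (g α) (partialDeriv a (g α) τ) τ (EuclideanSpace.single a 1) :=
    fun α => (((hg α).differentiable (by simp)) τ).lineDifferentiableAt.hasLineDerivAt
  refine HasLineDerivAt.lineDeriv ?_
  unfold HasLineDerivAt at h ⊢
  exact HasDerivAt.fun_sum fun α _ => (h α).const_smul (c α)

/-- The number of edges at the vertex `i`, in a list of edges. -/
def listDegree (L : List (Edge n)) (i : Fin n) : ℕ :=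
  L.countP fun ℓ => ℓ.1.1 = i ∨ ℓ.1.2 = i

/-- The forest operator maps a product to a combination of products of derivatives, the order of
the derivatives of each factor being at most the degree of its vertex. -/
lemma exists_foldr_edgeOp_eq (C : Matrix (Fin N) (Fin N) ℝ) (L : List (Edge n)) :
    ∃ (ι : Type) (_ : Fintype ι) (c : ι → ℝ) (D : ι → Fin n → List (Fin N)),
      (∀ α i, (D α i).length ≤ listDegree L i) ∧
      ∀ f : Fin n → EuclideanSpace ℝ (Fin N) → 𝕜, (∀ i, ContDiff ℝ ∞ (f i)) →
        L.foldr (edgeOp C) (fun τ => ∏ i, f i (replica τ i)) =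
          fun τ => ∑ α, c α • prodPartial f (D α) τ := by
  induction L with
  | nil =>
    refine ⟨Unit, inferInstance, fun _ => 1, fun _ _ => [], by simp, fun f _ => ?_⟩
    ext τ
    simp [prodPartial, iterPartial]
  | cons ℓ L ih =>
    obtain ⟨ι, _, c, D, hD, h⟩ := ih
    refine ⟨Fin N × Fin N × ι, inferInstance, fun x => C x.1 x.2.1 * c x.2.2,
      fun x => Function.update (Function.update (D x.2.2) ℓ.1.2 (x.2.1 :: D x.2.2 ℓ.1.2)) ℓ.1.1
        (x.1 :: D x.2.2 ℓ.1.1), ?_, fun f hf => ?_⟩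
    · rintro ⟨p, q, α⟩ i
      have hne := ℓ.2.ne
      rw [listDegree, List.countP_cons]
      have h1 := hD α i
      rw [listDegree] at h1
      by_cases hi1 : i = ℓ.1.1
      · subst hi1
        simpa using h1
      · by_cases hi2 : i = ℓ.1.2
        · subst hi2
          simpa [hi1] using h1
        · simpa [hi1, hi2, Ne.symm hi1, Ne.symm hi2] using h1
    · rw [List.foldr_cons, h f hf]
      ext τ
      simp only [edgeOp]
      have h2 : ∀ p q, partialDeriv (p, ℓ.1.1) (partialDeriv (q, ℓ.1.2)
          (fun τ => ∑ α, c α • prodPartial f (D α) τ)) τ = ∑ α, c α •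
          prodPartial f (Function.update (Function.update (D α) ℓ.1.2 (q :: D α ℓ.1.2)) ℓ.1.1
            (p :: D α ℓ.1.1)) τ := by
        intro p q
        rw [partialDeriv_sum _ _ fun α => contDiff_prodPartial hf (D α)]
        simp only [partialDeriv_prodPartial]
        rw [partialDeriv_sum _ _ fun α => contDiff_prodPartial hf _]
        simp only [partialDeriv_prodPartial, Function.update_of_ne ℓ.2.ne]
      simp only [h2, Fintype.sum_prod_type, Finset.smul_sum, smul_smul]

/-- Sending an edge at `i` to its other end is injective. This is why derivatives of order at most
`n - 1` suffice. -/
lemma listDegree_toList_lt (F : Finset (Edge n)) (i : Fin n) : listDegree F.toList i < n := by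
  classical
  have h1 : listDegree F.toList i = (F.filter fun ℓ => ℓ.1.1 = i ∨ ℓ.1.2 = i).card := by
    rw [listDegree, List.countP_eq_length_filter, Finset.card_def, Finset.filter_val,
      ← Multiset.coe_card, ← Multiset.filter_coe, Finset.coe_toList]
  have h2 : (F.filter fun ℓ => ℓ.1.1 = i ∨ ℓ.1.2 = i).card ≤ (Finset.univ.erase i).card := by
    refine Finset.card_le_card_of_injOn (fun ℓ => if ℓ.1.1 = i then ℓ.1.2 else ℓ.1.1) ?_ ?_
    · intro ℓ hℓ
      have := ℓ.2
      simp only [Finset.coe_filter, Set.mem_ofPred_eq] at hℓ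
      simp only [Finset.coe_erase, Finset.coe_univ, Set.mem_sdiff, Set.mem_univ, true_and,
        Set.mem_singleton_iff]
      split_ifs with h
      · exact fun h' => this.ne (h.trans h'.symm)
      · exact h
    · intro ℓ hℓ ℓ' hℓ' h
      have h3 := ℓ.2
      have h4 := ℓ'.2
      simp only [Finset.coe_filter, Set.mem_ofPred_eq] at hℓ hℓ'
      refine edge_sym2_injective ?_
      rw [Sym2.eq_iff]
      simp only at h
      grind
  rw [h1]
  refine h2.trans_lt ?_
  rw [Finset.card_erase_of_mem (Finset.mem_univ i), Finset.card_univ, Fintype.card_fin]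
  exact Nat.sub_lt (Fin.pos i) one_pos

/-- `K` is chosen before `f`, so one constant serves the functions and all their truncations. -/
lemma exists_norm_forestOp_le (C : Matrix (Fin N) (Fin N) ℝ) (F : Finset (Edge n)) :
    ∃ K : ℝ, 0 ≤ K ∧ ∀ f : Fin n → EuclideanSpace ℝ (Fin N) → 𝕜, (∀ i, ContDiff ℝ ∞ (f i)) →
      ∀ b : Fin n → EuclideanSpace ℝ (Fin N) → ℝ,
      (∀ i, ∀ k < n, ∀ x, ‖iteratedFDeriv ℝ k (f i) x‖ ≤ b i x) →
      ∀ τ, ‖forestOp C F (fun τ => ∏ i, f i (replica τ i)) τ‖ ≤ K * ∏ i, b i (replica τ i) := by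
  obtain ⟨ι, _, c, D, hD, h⟩ := exists_foldr_edgeOp_eq (𝕜 := 𝕜) C F.toList
  refine ⟨∑ α, |c α|, Finset.sum_nonneg fun α _ => abs_nonneg _, fun f hf b hb τ => ?_⟩
  rw [forestOp, h f hf, Finset.sum_mul]
  refine (norm_sum_le _ _).trans (Finset.sum_le_sum fun α _ => ?_)
  rw [norm_smul, Real.norm_eq_abs, prodPartial, norm_prod]
  refine mul_le_mul_of_nonneg_left (Finset.prod_le_prod (fun i _ => norm_nonneg _) fun i _ => ?_)
    (abs_nonneg _)
  exact (norm_iterPartial_le (hf i) _ _).trans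
    (hb i _ ((hD α i).trans_lt (listDegree_toList_lt F i)) _)

lemma continuous_forestOp_prod (C : Matrix (Fin N) (Fin N) ℝ) (F : Finset (Edge n))
    {f : Fin n → EuclideanSpace ℝ (Fin N) → 𝕜} (hf : ∀ i, ContDiff ℝ ∞ (f i)) :
    Continuous (forestOp C F fun τ => ∏ i, f i (replica τ i)) := by
  obtain ⟨ι, _, c, D, hD, h⟩ := exists_foldr_edgeOp_eq (𝕜 := 𝕜) C F.toList
  rw [forestOp, h f hf]
  exact continuous_finsetSum _ fun α _ => (contDiff_prodPartial hf _).continuous.const_smul _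

lemma eventuallyEq_partialDeriv {g h : EuclideanSpace ℝ (Fin N × Fin n) → 𝕜}
    {τ : EuclideanSpace ℝ (Fin N × Fin n)} (hgh : g =ᶠ[nhds τ] h) (a : Fin N × Fin n) :
    partialDeriv a g =ᶠ[nhds τ] partialDeriv a h := by
  filter_upwards [hgh.eventuallyEq_nhds] with τ' h'
  exact h'.lineDeriv_eq

/-- Locality of the operator: a truncation that is trivial near a point does not change the value
there. -/
lemma eventuallyEq_forestOp (C : Matrix (Fin N) (Fin N) ℝ) (F : Finset (Edge n))
    {g h : EuclideanSpace ℝ (Fin N × Fin n) → 𝕜}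
    {τ : EuclideanSpace ℝ (Fin N × Fin n)} (hgh : g =ᶠ[nhds τ] h) :
    forestOp C F g =ᶠ[nhds τ] forestOp C F h := by
  unfold forestOp
  induction F.toList with
  | nil => exact hgh
  | cons ℓ L ih =>
    simp only [List.foldr_cons]
    have h1 : ∀ᶠ τ' in nhds τ, ∀ p q,
        partialDeriv (p, ℓ.1.1) (partialDeriv (q, ℓ.1.2) (L.foldr (edgeOp C) g)) τ' =
        partialDeriv (p, ℓ.1.1) (partialDeriv (q, ℓ.1.2) (L.foldr (edgeOp C) h)) τ' := by
      simp only [Filter.eventually_all]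
      exact fun p q => eventuallyEq_partialDeriv (eventuallyEq_partialDeriv ih _) _
    filter_upwards [h1] with τ' h'
    simp only [edgeOp, h']

end Products

/-! ### Smooth truncation with uniform derivative bounds -/

section Cutoff

variable {𝕜 : Type*} [RCLike 𝕜] {V : Type*} [NormedAddCommGroup V] [InnerProductSpace ℝ V]
  [FiniteDimensional ℝ V]

/-- A smooth cutoff function. -/
noncomputable def bump (V : Type*) [NormedAddCommGroup V] [InnerProductSpace ℝ V]
    [FiniteDimensional ℝ V] : ContDiffBump (0 : V) where
  rIn := 1
  rOut := 2
  rIn_pos := one_pos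
  rIn_lt_rOut := one_lt_two

/-- The function `g` smoothly cut off outside the ball of radius `m + 1`. -/
noncomputable def cutoff (m : ℕ) (g : V → 𝕜) (x : V) : 𝕜 :=
  bump V (((m : ℝ) + 1)⁻¹ • x) • g x

lemma contDiff_cutoff {g : V → 𝕜} (hg : ContDiff ℝ ∞ g) (m : ℕ) : ContDiff ℝ ∞ (cutoff m g) :=
  ((bump V).contDiff.comp (contDiff_const_smul _)).smul hg

lemma cutoff_eq_self (g : V → 𝕜) {m : ℕ} {x : V} (hx : ‖x‖ ≤ m + 1) : cutoff m g x = g x := by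
  have hm : (0 : ℝ) < m + 1 := by positivity
  rw [cutoff, (bump V).one_of_mem_closedBall, one_smul]
  rw [mem_closedBall_zero_iff, norm_smul, norm_inv, Real.norm_of_nonneg hm.le,
    inv_mul_le_iff₀ hm]
  simpa [bump] using hx

lemma cutoff_eq_zero (g : V → 𝕜) {m : ℕ} {x : V} (hx : 2 * (m + 1) ≤ ‖x‖) : cutoff m g x = 0 := by
  have hm : (0 : ℝ) < m + 1 := by positivity
  rw [cutoff, (bump V).zero_of_le_dist, zero_smul]
  rw [dist_zero_right, norm_smul, norm_inv, Real.norm_of_nonneg hm.le, inv_mul_eq_div,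
    le_div_iff₀ hm]
  simpa [bump] using hx

lemma exists_norm_iteratedFDeriv_bump_le (k : ℕ) :
    ∃ B : ℝ, ∀ x : V, ‖iteratedFDeriv ℝ k (bump V) x‖ ≤ B := by
  have h1 : Continuous (iteratedFDeriv ℝ k (bump V)) :=
    ((bump V).contDiff (n := k)).continuous_iteratedFDeriv le_rfl
  exact ((bump V).hasCompactSupport.iteratedFDeriv k).exists_bound_of_continuous h1

/-- Leibniz rule. Rescaling by `(m + 1)⁻¹ ≤ 1` only shrinks the derivatives of the bump, so `B`
depends neither on `m` nor on `g`. -/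
lemma exists_norm_iteratedFDeriv_cutoff_le (n : ℕ) :
    ∃ B : ℝ, ∀ g : V → 𝕜, ContDiff ℝ ∞ g → ∀ m : ℕ, ∀ k < n, ∀ x,
      ‖iteratedFDeriv ℝ k (cutoff m g) x‖ ≤
        B * ∑ j ∈ Finset.range n, ‖iteratedFDeriv ℝ j g x‖ := by
  choose B hB using exists_norm_iteratedFDeriv_bump_le (V := V)
  have hB0 : ∀ k, 0 ≤ B k := fun k => (norm_nonneg _).trans (hB k 0)
  have hbump : ∀ (m k : ℕ) (x : V),
      ‖iteratedFDeriv ℝ k (fun x => bump V (((m : ℝ) + 1)⁻¹ • x)) x‖ ≤ B k := by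
    intro m k x
    have hm : (0 : ℝ) < m + 1 := by positivity
    have h1 := (((m : ℝ) + 1)⁻¹ • ContinuousLinearMap.id ℝ V).iteratedFDeriv_comp_right
      ((bump V).contDiff (n := k)) x (i := k) le_rfl
    have h2 : (fun x => bump V (((m : ℝ) + 1)⁻¹ • x)) =
        (bump V) ∘ (((m : ℝ) + 1)⁻¹ • ContinuousLinearMap.id ℝ V) := rfl
    rw [h2, h1]
    refine (ContinuousMultilinearMap.norm_compContinuousLinearMap_le _ _).trans ?_
    refine (mul_le_of_le_one_right (norm_nonneg _) ?_).trans (hB k _)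
    rw [Finset.prod_const]
    refine pow_le_one₀ (norm_nonneg _) ?_
    rw [norm_smul, norm_inv, Real.norm_of_nonneg hm.le]
    refine mul_le_one₀ (inv_le_one_of_one_le₀ (by simp)) (norm_nonneg _)
      ContinuousLinearMap.norm_id_le
  refine ⟨∑ k ∈ Finset.range n, ∑ j ∈ Finset.range (k + 1), k.choose j * B j,
    fun g hg m k hk x => ?_⟩
  have hc : ContDiff ℝ ∞ fun x : V => bump V (((m : ℝ) + 1)⁻¹ • x) :=
    (bump V).contDiff.comp (contDiff_const_smul _)
  have h1 := norm_iteratedFDeriv_smul_le hc hg (x := x) (n := k)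
    (by exact_mod_cast le_top)
  refine h1.trans ?_
  have hS : ∀ j < n, ‖iteratedFDeriv ℝ j g x‖ ≤
      ∑ j ∈ Finset.range n, ‖iteratedFDeriv ℝ j g x‖ := fun j hj =>
    Finset.single_le_sum (f := fun j => ‖iteratedFDeriv ℝ j g x‖) (fun _ _ => norm_nonneg _)
      (Finset.mem_range.2 hj)
  have h2 : ∑ j ∈ Finset.range (k + 1), (k.choose j : ℝ) * B j ≤
      ∑ k ∈ Finset.range n, ∑ j ∈ Finset.range (k + 1), k.choose j * B j :=
    Finset.single_le_sum (f := fun k => ∑ j ∈ Finset.range (k + 1), (k.choose j : ℝ) * B j)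
      (fun k _ => Finset.sum_nonneg fun j _ => mul_nonneg (Nat.cast_nonneg _) (hB0 j))
      (Finset.mem_range.2 hk)
  refine le_trans ?_ (mul_le_mul_of_nonneg_right h2
    (Finset.sum_nonneg fun _ _ => norm_nonneg _))
  rw [Finset.sum_mul]
  refine Finset.sum_le_sum fun j _ => ?_
  exact mul_le_mul (mul_le_mul_of_nonneg_left (hbump m j x) (Nat.cast_nonneg _))
    (hS _ (by omega)) (norm_nonneg _) (mul_nonneg (Nat.cast_nonneg _) (hB0 j))

end Cutoff

end ReplicaForest

namespace ReplicaForest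

open scoped InnerProductSpace

/-! ### Domination uniform in the weights, and removal of the truncation -/

section Domination

variable {𝕜 : Type*} [RCLike 𝕜] {N n : ℕ} {C : Matrix (Fin N) (Fin N) ℝ}

/-- Every replica has covariance `C`. -/
lemma map_replica_gaussian (hC : C.PosSemidef) {X : Matrix (Fin n) (Fin n) ℝ}
    (hX : X.PosSemidef) (hX1 : ∀ i, X i i = 1) (i : Fin n) :
    (gaussian (C ⊗ₖ X)).map (fun τ => replica τ i) = gaussian C := by
  have hm : Measurable fun τ : EuclideanSpace ℝ (Fin N × Fin n) => replica τ i :=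
    (contDiff_replica i).continuous.measurable
  have : IsProbabilityMeasure ((gaussian (C ⊗ₖ X)).map (fun τ => replica τ i)) :=
    Measure.isProbabilityMeasure_map hm.aemeasurable
  refine Measure.ext_of_charFun ?_
  ext ξ
  -- Testing the `i`-th replica against `ξ` is testing all replicas against `ξ` placed in slot `i`,
  -- so only `X i i = 1` enters.
  rw [charFun_map_eq (η := WithLp.toLp 2 fun a => if a.2 = i then ξ a.1 else 0) hm,
    charFun_gaussian (hC.kronecker hX), charFun_gaussian hC, dotProduct_kronecker_mulVec]
  · congr 4
    rw [Finset.sum_eq_single_of_mem i (Finset.mem_univ i),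
      Finset.sum_eq_single_of_mem i (Finset.mem_univ i), hX1, one_mul]
    · simp only [replicaForm, dotProduct, Matrix.mulVec, if_true, Finset.mul_sum]
      refine Finset.sum_congr rfl fun p _ => Finset.sum_congr rfl fun q _ => ?_
      ring
    · intro j _ hj
      simp [replicaForm, hj]
    · intro j _ hj
      simp [replicaForm, hj]
  · intro τ
    simp [replica, PiLp.inner_apply, Fintype.sum_prod_type]

/-- The sum of the norms of the derivatives of order less than `n`. -/
noncomputable def derivSum (n : ℕ) (g : EuclideanSpace ℝ (Fin N) → 𝕜)
    (x : EuclideanSpace ℝ (Fin N)) : ℝ :=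
  ∑ j ∈ Finset.range n, ‖iteratedFDeriv ℝ j g x‖

lemma derivSum_nonneg (g : EuclideanSpace ℝ (Fin N) → 𝕜) (x : EuclideanSpace ℝ (Fin N)) :
    0 ≤ derivSum n g x :=
  Finset.sum_nonneg fun _ _ => norm_nonneg _

lemma norm_iteratedFDeriv_le_derivSum (g : EuclideanSpace ℝ (Fin N) → 𝕜) {k : ℕ} (hk : k < n)
    (x : EuclideanSpace ℝ (Fin N)) : ‖iteratedFDeriv ℝ k g x‖ ≤ derivSum n g x :=
  Finset.single_le_sum (f := fun j => ‖iteratedFDeriv ℝ j g x‖) (fun _ _ => norm_nonneg _)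
    (Finset.mem_range.2 hk)

/-- Bound every factor by the largest one. The summand 1 covers the empty product at `n = 0`. Unlike
the product, the right side involves one replica per term, so its integral depends only on the
marginals. -/
lemma prod_le_one_add_sum_pow {b : Fin n → ℝ} (hb : ∀ i, 0 ≤ b i) :
    ∏ i, b i ≤ 1 + ∑ i, b i ^ n := by
  rcases Nat.eq_zero_or_pos n with rfl | hn
  · simp
  · have : Nonempty (Fin n) := ⟨⟨0, hn⟩⟩
    obtain ⟨i, -, hi⟩ := Finset.exists_max_image Finset.univ b Finset.univ_nonempty
    have h1 : ∏ j, b j ≤ b i ^ n := by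
      refine (Finset.prod_le_prod (fun j _ => hb j) fun j _ => hi j (Finset.mem_univ j)).trans ?_
      simp
    have h2 : b i ^ n ≤ ∑ i, b i ^ n :=
      Finset.single_le_sum (f := fun i => b i ^ n) (fun j _ => pow_nonneg (hb j) n)
        (Finset.mem_univ i)
    linarith

lemma integrable_derivSum_pow {g : EuclideanSpace ℝ (Fin N) → 𝕜}
    (hg : ∀ k < n, MemLp (iteratedFDeriv ℝ k g) n (gaussian C)) (c : ℝ) :
    Integrable (fun x => (c * derivSum n g x) ^ n) (gaussian C) := by
  have h1 : MemLp (fun x => c * derivSum n g x) n (gaussian C) :=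
    (memLp_finsetSum _ fun j hj => (hg j (Finset.mem_range.1 hj)).norm).const_mul c
  refine h1.integrable_norm_pow'.mono
    ((h1.aestronglyMeasurable).pow n) (Filter.Eventually.of_forall fun x => ?_)
  simp

variable {f : Fin n → EuclideanSpace ℝ (Fin N) → 𝕜}

/-- The integrable function dominating the terms of the forest formula. -/
noncomputable def dominator (f : Fin n → EuclideanSpace ℝ (Fin N) → 𝕜) (c : ℝ)
    (τ : EuclideanSpace ℝ (Fin N × Fin n)) : ℝ :=
  1 + ∑ i, (c * derivSum n (f i) (replica τ i)) ^ n

lemma prod_le_dominator (f : Fin n → EuclideanSpace ℝ (Fin N) → 𝕜) {c : ℝ} (hc : 0 ≤ c)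
    (τ : EuclideanSpace ℝ (Fin N × Fin n)) :
    ∏ i, (c * derivSum n (f i) (replica τ i)) ≤ dominator f c τ :=
  prod_le_one_add_sum_pow fun _ => mul_nonneg hc (derivSum_nonneg _ _)

lemma integrable_dominator_diagonal
    (hfL : ∀ i, ∀ k < n, MemLp (iteratedFDeriv ℝ k (f i)) n (gaussian C)) (c : ℝ) :
    Integrable (fun τ => dominator f c (diagonal n τ)) (gaussian C) :=
  (integrable_const 1).add (integrable_finsetSum _ fun i _ => integrable_derivSum_pow (hfL i) c)

lemma integrable_pow_replica (hC : C.PosSemidef) {X : Matrix (Fin n) (Fin n) ℝ}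
    (hX : X.PosSemidef) (hX1 : ∀ i, X i i = 1)
    (hfL : ∀ i, ∀ k < n, MemLp (iteratedFDeriv ℝ k (f i)) n (gaussian C)) (c : ℝ) (i : Fin n) :
    Integrable (fun τ => (c * derivSum n (f i) (replica τ i)) ^ n) (gaussian (C ⊗ₖ X)) := by
  have h1 := integrable_derivSum_pow (hfL i) c
  rw [← map_replica_gaussian hC hX hX1 i] at h1
  exact h1.comp_measurable (contDiff_replica i).continuous.measurable

lemma integrable_dominator (hC : C.PosSemidef) {X : Matrix (Fin n) (Fin n) ℝ}
    (hX : X.PosSemidef) (hX1 : ∀ i, X i i = 1)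
    (hfL : ∀ i, ∀ k < n, MemLp (iteratedFDeriv ℝ k (f i)) n (gaussian C)) (c : ℝ) :
    Integrable (dominator f c) (gaussian (C ⊗ₖ X)) :=
  (integrable_const 1).add
    (integrable_finsetSum _ fun i _ => integrable_pow_replica hC hX hX1 hfL c i)

/-- The value does not involve `X`: this is the uniformity needed to integrate over the weights. -/
lemma integral_dominator (hC : C.PosSemidef) {X : Matrix (Fin n) (Fin n) ℝ}
    (hX : X.PosSemidef) (hX1 : ∀ i, X i i = 1)
    (hfL : ∀ i, ∀ k < n, MemLp (iteratedFDeriv ℝ k (f i)) n (gaussian C)) (c : ℝ) :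
    ∫ τ, dominator f c τ ∂gaussian (C ⊗ₖ X) =
      1 + ∑ i, ∫ x, (c * derivSum n (f i) x) ^ n ∂gaussian C := by
  unfold dominator
  rw [integral_add (integrable_const 1)
    (integrable_finsetSum _ fun i _ => integrable_pow_replica hC hX hX1 hfL c i),
    integral_finsetSum _ fun i _ => integrable_pow_replica hC hX hX1 hfL c i]
  congr 1
  · simp
  · refine Finset.sum_congr rfl fun i _ => ?_
    have h1 := (integrable_derivSum_pow (hfL i) c).aestronglyMeasurable
    rw [← map_replica_gaussian hC hX hX1 i] at h1 ⊢
    exact (integral_map (contDiff_replica i).continuous.measurable.aemeasurable h1).symm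

/-- Uniform bounds for the functions `f i` and their truncations. -/
lemma exists_derivSum_bounds (f : Fin n → EuclideanSpace ℝ (Fin N) → 𝕜)
    (hf : ∀ i, ContDiff ℝ ∞ (f i)) :
    ∃ c : ℝ, 0 ≤ c ∧ (∀ i, ∀ k < n, ∀ x, ‖iteratedFDeriv ℝ k (f i) x‖ ≤ c * derivSum n (f i) x) ∧
      ∀ m i, ∀ k < n, ∀ x,
        ‖iteratedFDeriv ℝ k (cutoff m (f i)) x‖ ≤ c * derivSum n (f i) x := by
  obtain ⟨B, hB⟩ := exists_norm_iteratedFDeriv_cutoff_le (𝕜 := 𝕜)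
    (V := EuclideanSpace ℝ (Fin N)) n
  -- `B` serves the truncations, 1 the functions themselves.
  refine ⟨max B 1, zero_le_one.trans (le_max_right _ _), fun i k hk x => ?_,
    fun m i k hk x => ?_⟩
  · refine (norm_iteratedFDeriv_le_derivSum (f i) hk x).trans ?_
    exact le_mul_of_one_le_left (derivSum_nonneg _ _) (le_max_right _ _)
  · exact (hB (f i) (hf i) m k hk x).trans
      (mul_le_mul_of_nonneg_right (le_max_left _ _) (derivSum_nonneg _ _))

/-- The terms of the forest formula are dominated uniformly in the truncation and the weights. -/
lemma exists_forestOp_dominated (C : Matrix (Fin N) (Fin N) ℝ) (F : Finset (Edge n))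
    (hf : ∀ i, ContDiff ℝ ∞ (f i)) :
    ∃ K c : ℝ, 0 ≤ K ∧
      (∀ τ, ‖forestOp C F (fun τ => ∏ i, f i (replica τ i)) τ‖ ≤ K * dominator f c τ) ∧
      ∀ m τ, ‖forestOp C F (fun τ => ∏ i, cutoff m (f i) (replica τ i)) τ‖ ≤
        K * dominator f c τ := by
  obtain ⟨c, hc, h1, h2⟩ := exists_derivSum_bounds f hf
  obtain ⟨K, hK, h3⟩ := exists_norm_forestOp_le (𝕜 := 𝕜) C F
  refine ⟨K, c, hK, fun τ => ?_, fun m τ => ?_⟩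
  · exact (h3 f hf (fun i x => c * derivSum n (f i) x) h1 τ).trans
      (mul_le_mul_of_nonneg_left (prod_le_dominator f hc τ) hK)
  · exact (h3 (fun i => cutoff m (f i)) (fun i => contDiff_cutoff (hf i) m)
      (fun i x => c * derivSum n (f i) x) (h2 m) τ).trans
      (mul_le_mul_of_nonneg_left (prod_le_dominator f hc τ) hK)

lemma exists_prod_dominated (hf : ∀ i, ContDiff ℝ ∞ (f i)) :
    ∃ c : ℝ, (∀ τ, ‖∏ i, f i τ‖ ≤ dominator f c (diagonal n τ)) ∧
      ∀ m τ, ‖∏ i, cutoff m (f i) τ‖ ≤ dominator f c (diagonal n τ) := by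
  obtain ⟨c, hc, h1, h2⟩ := exists_derivSum_bounds f hf
  refine ⟨c, fun τ => ?_, fun m τ => ?_⟩
  · refine le_trans ?_ (prod_le_dominator f hc (diagonal n τ))
    rw [norm_prod]
    refine Finset.prod_le_prod (fun i _ => norm_nonneg _) fun i _ => ?_
    have h3 := h1 i 0 (Fin.pos i) τ
    rw [norm_iteratedFDeriv_zero] at h3
    exact h3
  · refine le_trans ?_ (prod_le_dominator f hc (diagonal n τ))
    rw [norm_prod]
    refine Finset.prod_le_prod (fun i _ => norm_nonneg _) fun i _ => ?_
    have h3 := h2 m i 0 (Fin.pos i) τ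
    rw [norm_iteratedFDeriv_zero] at h3
    exact h3

lemma integrable_prod (hf : ∀ i, ContDiff ℝ ∞ (f i))
    (hfL : ∀ i, ∀ k < n, MemLp (iteratedFDeriv ℝ k (f i)) n (gaussian C)) :
    Integrable (fun τ => ∏ i, f i τ) (gaussian C) := by
  obtain ⟨c, h1, -⟩ := exists_prod_dominated hf
  exact (integrable_dominator_diagonal hfL c).mono'
    (continuous_finsetProd _ fun i _ => (hf i).continuous).aestronglyMeasurable
    (Filter.Eventually.of_forall h1)

lemma integrable_forestOp (hC : C.PosSemidef) {X : Matrix (Fin n) (Fin n) ℝ}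
    (hX : X.PosSemidef) (hX1 : ∀ i, X i i = 1) (hf : ∀ i, ContDiff ℝ ∞ (f i))
    (hfL : ∀ i, ∀ k < n, MemLp (iteratedFDeriv ℝ k (f i)) n (gaussian C)) (F : Finset (Edge n)) :
    Integrable (forestOp C F fun τ => ∏ i, f i (replica τ i)) (gaussian (C ⊗ₖ X)) := by
  obtain ⟨K, c, -, h1, -⟩ := exists_forestOp_dominated C F hf
  exact ((integrable_dominator hC hX hX1 hfL c).const_mul K).mono'
    (continuous_forestOp_prod C F hf).aestronglyMeasurable (Filter.Eventually.of_forall h1)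

lemma exists_norm_integral_forestOp_le (hC : C.PosSemidef) (hf : ∀ i, ContDiff ℝ ∞ (f i))
    (hfL : ∀ i, ∀ k < n, MemLp (iteratedFDeriv ℝ k (f i)) n (gaussian C)) (F : Finset (Edge n)) :
    ∃ M : ℝ, ∀ X : Matrix (Fin n) (Fin n) ℝ, X.PosSemidef → (∀ i, X i i = 1) →
      ‖∫ τ, forestOp C F (fun τ => ∏ i, f i (replica τ i)) τ ∂gaussian (C ⊗ₖ X)‖ ≤ M ∧
      ∀ m, ‖∫ τ, forestOp C F (fun τ => ∏ i, cutoff m (f i) (replica τ i)) τ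
        ∂gaussian (C ⊗ₖ X)‖ ≤ M := by
  obtain ⟨K, c, -, h1, h2⟩ := exists_forestOp_dominated C F hf
  refine ⟨K * (1 + ∑ i, ∫ x, (c * derivSum n (f i) x) ^ n ∂gaussian C), fun X hX hX1 => ?_⟩
  rw [← integral_dominator hC hX hX1 hfL c, ← integral_const_mul]
  have hi := (integrable_dominator hC hX hX1 hfL c).const_mul K
  exact ⟨norm_integral_le_of_norm_le hi (Filter.Eventually.of_forall h1),
    fun m => norm_integral_le_of_norm_le hi (Filter.Eventually.of_forall (h2 m))⟩

lemma eventually_cutoff_eq (g : EuclideanSpace ℝ (Fin N) → 𝕜) (x : EuclideanSpace ℝ (Fin N)) :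
    ∀ᶠ m : ℕ in Filter.atTop, cutoff m g =ᶠ[nhds x] g := by
  filter_upwards [Filter.eventually_ge_atTop ⌈‖x‖⌉₊] with m hm
  have h1 : ‖x‖ < m + 1 := (Nat.le_of_ceil_le hm).trans_lt (lt_add_one _)
  filter_upwards [(isOpen_lt continuous_norm continuous_const).mem_nhds h1] with y hy
  exact cutoff_eq_self g (le_of_lt hy)

lemma tendsto_integral_prod_cutoff (hf : ∀ i, ContDiff ℝ ∞ (f i))
    (hfL : ∀ i, ∀ k < n, MemLp (iteratedFDeriv ℝ k (f i)) n (gaussian C)) :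
    Filter.Tendsto (fun m => ∫ τ, ∏ i, cutoff m (f i) τ ∂gaussian C) Filter.atTop
      (nhds (∫ τ, ∏ i, f i τ ∂gaussian C)) := by
  obtain ⟨c, -, h2⟩ := exists_prod_dominated hf
  refine tendsto_integral_of_dominated_convergence _ (fun m => ?_)
    (integrable_dominator_diagonal hfL c) (fun m => Filter.Eventually.of_forall (h2 m))
    (Filter.Eventually.of_forall fun τ => ?_)
  · exact (continuous_finsetProd _ fun i _ =>
      (contDiff_cutoff (hf i) m).continuous).aestronglyMeasurable
  · refine tendsto_finsetProd _ fun i _ => ?_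
    exact tendsto_const_nhds.congr' ((eventually_cutoff_eq (f i) τ).mono fun m h =>
      h.self_of_nhds.symm)

lemma tendsto_integral_forestOp_cutoff (hC : C.PosSemidef) {X : Matrix (Fin n) (Fin n) ℝ}
    (hX : X.PosSemidef) (hX1 : ∀ i, X i i = 1) (hf : ∀ i, ContDiff ℝ ∞ (f i))
    (hfL : ∀ i, ∀ k < n, MemLp (iteratedFDeriv ℝ k (f i)) n (gaussian C)) (F : Finset (Edge n)) :
    Filter.Tendsto (fun m => ∫ τ, forestOp C F (fun τ => ∏ i, cutoff m (f i) (replica τ i)) τ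
      ∂gaussian (C ⊗ₖ X)) Filter.atTop
      (nhds (∫ τ, forestOp C F (fun τ => ∏ i, f i (replica τ i)) τ ∂gaussian (C ⊗ₖ X))) := by
  obtain ⟨K, c, -, -, h2⟩ := exists_forestOp_dominated C F hf
  refine tendsto_integral_of_dominated_convergence _ (fun m => ?_)
    ((integrable_dominator hC hX hX1 hfL c).const_mul K)
    (fun m => Filter.Eventually.of_forall (h2 m)) (Filter.Eventually.of_forall fun τ => ?_)
  · exact (continuous_forestOp_prod C F fun i => contDiff_cutoff (hf i) m).aestronglyMeasurable
  · refine tendsto_const_nhds.congr' ?_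
    -- For large `m` the truncation is trivial near every replica of `τ`, so the sequence is
    -- eventually constant.
    have h3 : ∀ᶠ m : ℕ in Filter.atTop, ∀ i, cutoff m (f i) =ᶠ[nhds (replica τ i)] f i :=
      Filter.eventually_all.2 fun i => eventually_cutoff_eq (f i) _
    filter_upwards [h3] with m hm
    refine (Filter.EventuallyEq.eq_of_nhds (eventuallyEq_forestOp C F ?_)).symm
    have h4 : ∀ᶠ τ' in nhds τ, ∀ i, cutoff m (f i) (replica τ' i) = f i (replica τ' i) :=
      Filter.eventually_all.2 fun i =>
        (contDiff_replica i).continuous.continuousAt.eventually (hm i)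
    filter_upwards [h4] with τ' h'
    simp only [h']

lemma norm_sq_eq_sum_replica (τ : EuclideanSpace ℝ (Fin N × Fin n)) :
    ‖τ‖ ^ 2 = ∑ i, ‖replica τ i‖ ^ 2 := by
  simp only [EuclideanSpace.norm_sq_eq, Fintype.sum_prod_type, replica]
  exact Finset.sum_comm

lemma hasCompactSupport_prod_cutoff (f : Fin n → EuclideanSpace ℝ (Fin N) → 𝕜) (m : ℕ) :
    HasCompactSupport fun τ : EuclideanSpace ℝ (Fin N × Fin n) =>
      ∏ i, cutoff m (f i) (replica τ i) := by
  refine HasCompactSupport.intro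
    (isCompact_closedBall 0 (Real.sqrt (n * (2 * (m + 1)) ^ 2))) fun τ hτ => ?_
  by_contra h0
  refine hτ ?_
  rw [mem_closedBall_zero_iff]
  refine Real.le_sqrt_of_sq_le ?_
  rw [norm_sq_eq_sum_replica]
  -- A nonzero product has no vanishing factor, which confines each replica to the ball of radius `2
  -- * (m + 1)`.
  have h1 : ∀ i, ‖replica τ i‖ ^ 2 ≤ (2 * ((m : ℝ) + 1)) ^ 2 := by
    intro i
    refine pow_le_pow_left₀ (norm_nonneg _) ?_ 2
    by_contra h2
    exact h0 (Finset.prod_eq_zero (Finset.mem_univ i) (cutoff_eq_zero _ (not_le.1 h2).le))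
  refine (Finset.sum_le_sum fun i _ => h1 i).trans ?_
  simp

end Domination

/-! ### The formula for complex-valued functions -/

section Complex

variable {N n : ℕ} {C : Matrix (Fin N) (Fin N) ℝ} {f : Fin n → EuclideanSpace ℝ (Fin N) → ℂ}

lemma exists_schwartz_prod_cutoff (hf : ∀ i, ContDiff ℝ ∞ (f i)) (m : ℕ) :
    ∃ G : SchwartzMap (EuclideanSpace ℝ (Fin N × Fin n)) ℂ,
      ⇑G = fun τ => ∏ i, cutoff m (f i) (replica τ i) :=
  ⟨(hasCompactSupport_prod_cutoff f m).toSchwartzMap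
    (contDiff_prod fun i _ => (contDiff_cutoff (hf i) m).comp (contDiff_replica i)), rfl⟩

lemma aestronglyMeasurable_integral_forestOp (hC : C.PosSemidef) (hf : ∀ i, ContDiff ℝ ∞ (f i))
    (hfL : ∀ i, ∀ k < n, MemLp (iteratedFDeriv ℝ k (f i)) n (gaussian C)) {F : Finset (Edge n)}
    (hF : (graph F).IsAcyclic) :
    AEStronglyMeasurable (fun w => ∫ τ, forestOp C F (fun τ => ∏ i, f i (replica τ i)) τ
      ∂gaussian (C ⊗ₖ forestMatrix F w)) (volume.restrict (unitCube F)) := by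
  refine aestronglyMeasurable_of_tendsto_ae Filter.atTop
    (f := fun m w => ∫ τ, forestOp C F (fun τ => ∏ i, cutoff m (f i) (replica τ i)) τ
      ∂gaussian (C ⊗ₖ forestMatrix F w)) (fun m => ?_) ?_
  · obtain ⟨G, hG⟩ := exists_schwartz_prod_cutoff hf m
    rw [← hG]
    exact aestronglyMeasurable_integral_forestOp_schwartz G hC hF
  · filter_upwards [ae_restrict_mem (measurableSet_unitCube (F := F))] with w hw
    exact tendsto_integral_forestOp_cutoff hC (posSemidef_forestMatrix hF hw)
      (fun i => forestMatrix_self w) hf hfL F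

/-- The forest formula for complex-valued functions. -/
theorem integral_prod_eq_sum_forests_complex (hC : C.PosSemidef) (hf : ∀ i, ContDiff ℝ ∞ (f i))
    (hfL : ∀ i, ∀ k < n, MemLp (iteratedFDeriv ℝ k (f i)) n (gaussian C)) :
    ∫ τ, ∏ i, f i τ ∂gaussian C = ∑ F ∈ forests n, ∫ w in unitCube F,
      ∫ τ, forestOp C F (fun τ => ∏ i, f i (replica τ i)) τ
        ∂gaussian (C ⊗ₖ forestMatrix F w) := by
  refine tendsto_nhds_unique (tendsto_integral_prod_cutoff hf hfL) ?_
  have h1 : ∀ m, ∫ τ, ∏ i, cutoff m (f i) τ ∂gaussian C = ∑ F ∈ forests n, ∫ w in unitCube F,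
      ∫ τ, forestOp C F (fun τ => ∏ i, cutoff m (f i) (replica τ i)) τ
        ∂gaussian (C ⊗ₖ forestMatrix F w) := by
    intro m
    obtain ⟨G, hG⟩ := exists_schwartz_prod_cutoff hf m
    have h2 := integral_diagonal_schwartz G hC
    rw [hG] at h2
    exact h2
  simp only [h1]
  refine tendsto_finsetSum _ fun F hF => ?_
  rw [mem_forests] at hF
  obtain ⟨M, hM⟩ := exists_norm_integral_forestOp_le hC hf hfL F
  refine tendsto_integral_of_dominated_convergence (fun _ => M) (fun m => ?_)
    (integrable_const M) (fun m => ?_) ?_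
  · obtain ⟨G, hG⟩ := exists_schwartz_prod_cutoff hf m
    rw [← hG]
    exact aestronglyMeasurable_integral_forestOp_schwartz G hC hF
  · filter_upwards [ae_restrict_mem (measurableSet_unitCube (F := F))] with w hw
    exact (hM _ (posSemidef_forestMatrix hF hw) fun i => forestMatrix_self w).2 m
  · filter_upwards [ae_restrict_mem (measurableSet_unitCube (F := F))] with w hw
    exact tendsto_integral_forestOp_cutoff hC (posSemidef_forestMatrix hF hw)
      (fun i => forestMatrix_self w) hf hfL F

end Complex

/-! ### Transfer from complex to general scalars, and the theorem -/

section Scalars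

variable {𝕜 : Type*} [RCLike 𝕜] {N n : ℕ}

lemma map_complex_map (x : 𝕜) : RCLike.map ℂ 𝕜 (RCLike.map 𝕜 ℂ x) = x := by
  simp [RCLike.map_apply, RCLike.re_add_im]

lemma map_complex_injective : Function.Injective (RCLike.map 𝕜 ℂ) :=
  Function.LeftInverse.injective map_complex_map

lemma map_complex_mul (x y : 𝕜) :
    RCLike.map 𝕜 ℂ (x * y) = RCLike.map 𝕜 ℂ x * RCLike.map 𝕜 ℂ y := by
  apply Complex.ext <;> simp [RCLike.map_apply, RCLike.mul_re, RCLike.mul_im]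

lemma map_complex_prod {ι : Type*} (s : Finset ι) (x : ι → 𝕜) :
    RCLike.map 𝕜 ℂ (∏ i ∈ s, x i) = ∏ i ∈ s, RCLike.map 𝕜 ℂ (x i) := by
  classical
  induction s using Finset.induction_on with
  | empty => simp [RCLike.map_apply]
  | insert i s hi ih => rw [Finset.prod_insert hi, Finset.prod_insert hi, map_complex_mul, ih]

lemma contDiff_partialDeriv {g : EuclideanSpace ℝ (Fin N × Fin n) → 𝕜} (hg : ContDiff ℝ ∞ g)
    (a : Fin N × Fin n) : ContDiff ℝ ∞ (partialDeriv a g) := by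
  have h1 : partialDeriv a g = fun τ => fderiv ℝ g τ (EuclideanSpace.single a 1) := by
    ext τ
    exact ((hg.differentiable (by simp)) τ).lineDeriv_eq_fderiv
  rw [h1]
  exact (hg.fderiv_right (m := ∞) (by simp)).clm_apply contDiff_const

lemma contDiff_edgeOp {g : EuclideanSpace ℝ (Fin N × Fin n) → 𝕜} (hg : ContDiff ℝ ∞ g)
    (C : Matrix (Fin N) (Fin N) ℝ) (ℓ : Edge n) : ContDiff ℝ ∞ (edgeOp C ℓ g) :=
  ContDiff.sum fun p _ => ContDiff.sum fun q _ =>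
    (contDiff_partialDeriv (contDiff_partialDeriv hg _) _).const_smul (C p q)

lemma partialDeriv_map_complex {g : EuclideanSpace ℝ (Fin N × Fin n) → 𝕜} (hg : ContDiff ℝ ∞ g)
    (a : Fin N × Fin n) :
    partialDeriv a (fun τ => RCLike.map 𝕜 ℂ (g τ)) = fun τ => RCLike.map 𝕜 ℂ (partialDeriv a g τ) := by
  ext τ
  have h : HasLineDerivAt ℝ g (partialDeriv a g τ) τ (EuclideanSpace.single a 1) :=
    ((hg.differentiable (by simp)) τ).lineDifferentiableAt.hasLineDerivAt
  refine HasLineDerivAt.lineDeriv ?_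
  unfold HasLineDerivAt at h ⊢
  exact (RCLike.map 𝕜 ℂ).hasFDerivAt.comp_hasDerivAt _ h

lemma forestOp_map_complex {g : EuclideanSpace ℝ (Fin N × Fin n) → 𝕜} (hg : ContDiff ℝ ∞ g)
    (C : Matrix (Fin N) (Fin N) ℝ) (F : Finset (Edge n)) :
    forestOp C F (fun τ => RCLike.map 𝕜 ℂ (g τ)) = fun τ => RCLike.map 𝕜 ℂ (forestOp C F g τ) := by
  suffices h : ∀ L : List (Edge n), ContDiff ℝ ∞ (L.foldr (edgeOp C) g) ∧
      L.foldr (edgeOp C) (fun τ => RCLike.map 𝕜 ℂ (g τ)) =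
        fun τ => RCLike.map 𝕜 ℂ (L.foldr (edgeOp C) g τ) from (h F.toList).2
  intro L
  induction L with
  | nil => exact ⟨hg, rfl⟩
  | cons ℓ L ih =>
    simp only [List.foldr_cons]
    refine ⟨contDiff_edgeOp ih.1 C ℓ, ?_⟩
    rw [ih.2]
    ext τ
    simp only [edgeOp, partialDeriv_map_complex ih.1,
      partialDeriv_map_complex (contDiff_partialDeriv ih.1 _), map_sum, map_smul]

lemma memLp_iteratedFDeriv_map_complex {μ : Measure (EuclideanSpace ℝ (Fin N))} {p : ENNReal}
    {g : EuclideanSpace ℝ (Fin N) → 𝕜} (hg : ContDiff ℝ ∞ g) {k : ℕ}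
    (h : MemLp (iteratedFDeriv ℝ k g) p μ) :
    MemLp (iteratedFDeriv ℝ k fun x => RCLike.map 𝕜 ℂ (g x)) p μ := by
  refine MemLp.of_le_mul (c := ‖RCLike.map 𝕜 ℂ‖) h ?_ (Filter.Eventually.of_forall fun x => ?_)
  · exact ((RCLike.map 𝕜 ℂ).contDiff.comp hg).continuous_iteratedFDeriv
      (by exact_mod_cast le_top) |>.aestronglyMeasurable
  · exact (RCLike.map 𝕜 ℂ).norm_iteratedFDeriv_comp_left hg.contDiffAt
      (by exact_mod_cast le_top)

end Scalars

end ReplicaForest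

theorem corollary2p3 {𝕜 : Type*} [RCLike 𝕜] (N n : ℕ)
    (C : Matrix (Fin N) (Fin N) ℝ) (hC : C.PosSemidef)
    (f : Fin n → EuclideanSpace ℝ (Fin N) → 𝕜)
    (hf : ∀ i, ContDiff ℝ ∞ (f i))
    (hfL : ∀ i, ∀ k < n,
      MemLp (iteratedFDeriv ℝ k (f i)) n (ReplicaForest.gaussian C)) :
    Integrable (fun τ => ∏ i, f i τ) (ReplicaForest.gaussian C) ∧
    (∀ F ∈ ReplicaForest.forests n,
      (∀ w ∈ ReplicaForest.unitCube F,
        (ReplicaForest.forestMatrix F w).PosSemidef ∧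
        Integrable
          (ReplicaForest.forestOp C F fun τ => ∏ i, f i (ReplicaForest.replica τ i))
          (ReplicaForest.gaussian (C ⊗ₖ ReplicaForest.forestMatrix F w))) ∧
      IntegrableOn
        (fun w => ∫ τ,
          ReplicaForest.forestOp C F (fun τ' => ∏ i, f i (ReplicaForest.replica τ' i)) τ
            ∂(ReplicaForest.gaussian (C ⊗ₖ ReplicaForest.forestMatrix F w)))
        (ReplicaForest.unitCube F)) ∧
    ∫ τ, ∏ i, f i τ ∂(ReplicaForest.gaussian C) =
      ∑ F ∈ ReplicaForest.forests n,
        ∫ w in ReplicaForest.unitCube F,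
          ∫ τ,
            ReplicaForest.forestOp C F (fun τ' => ∏ i, f i (ReplicaForest.replica τ' i)) τ
              ∂(ReplicaForest.gaussian (C ⊗ₖ ReplicaForest.forestMatrix F w)) := by
  have hf' : ∀ i, ContDiff ℝ ∞ fun x => RCLike.map 𝕜 ℂ (f i x) :=
    fun i => (RCLike.map 𝕜 ℂ).contDiff.comp (hf i)
  have hfL' : ∀ i, ∀ k < n, MemLp (iteratedFDeriv ℝ k fun x => RCLike.map 𝕜 ℂ (f i x)) n
      (ReplicaForest.gaussian C) :=
    fun i k hk => ReplicaForest.memLp_iteratedFDeriv_map_complex (hf i) (hfL i k hk)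
  have hprod : ContDiff ℝ ∞ fun τ : EuclideanSpace ℝ (Fin N × Fin n) =>
      ∏ i, f i (ReplicaForest.replica τ i) :=
    contDiff_prod fun i _ => (hf i).comp (ReplicaForest.contDiff_replica i)
  have hop : ∀ F, ReplicaForest.forestOp C F
      (fun τ => ∏ i, RCLike.map 𝕜 ℂ (f i (ReplicaForest.replica τ i))) = fun τ => RCLike.map 𝕜 ℂ
      (ReplicaForest.forestOp C F (fun τ => ∏ i, f i (ReplicaForest.replica τ i)) τ) := by
    intro F
    rw [← ReplicaForest.forestOp_map_complex hprod]
    simp only [ReplicaForest.map_complex_prod]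
  have hint : ∀ F ∈ ReplicaForest.forests n, ∀ w ∈ ReplicaForest.unitCube F, Integrable
      (ReplicaForest.forestOp C F fun τ => ∏ i, f i (ReplicaForest.replica τ i))
      (ReplicaForest.gaussian (C ⊗ₖ ReplicaForest.forestMatrix F w)) := by
    intro F hF w hw
    exact ReplicaForest.integrable_forestOp hC
      (ReplicaForest.posSemidef_forestMatrix (ReplicaForest.mem_forests.1 hF) hw)
      (fun i => ReplicaForest.forestMatrix_self w) hf hfL F
  have hcomm : ∀ F ∈ ReplicaForest.forests n, ∀ w ∈ ReplicaForest.unitCube F,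
      ∫ τ, ReplicaForest.forestOp C F
        (fun τ => ∏ i, RCLike.map 𝕜 ℂ (f i (ReplicaForest.replica τ i))) τ
          ∂(ReplicaForest.gaussian (C ⊗ₖ ReplicaForest.forestMatrix F w)) =
      RCLike.map 𝕜 ℂ (∫ τ, ReplicaForest.forestOp C F
        (fun τ => ∏ i, f i (ReplicaForest.replica τ i)) τ
          ∂(ReplicaForest.gaussian (C ⊗ₖ ReplicaForest.forestMatrix F w))) := by
    intro F hF w hw
    rw [hop]
    exact (RCLike.map 𝕜 ℂ).integral_comp_comm (hint F hF w hw)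
  have hcube : ∀ F ∈ ReplicaForest.forests n, IntegrableOn
      (fun w => ∫ τ, ReplicaForest.forestOp C F
        (fun τ' => ∏ i, f i (ReplicaForest.replica τ' i)) τ
          ∂(ReplicaForest.gaussian (C ⊗ₖ ReplicaForest.forestMatrix F w)))
      (ReplicaForest.unitCube F) := by
    intro F hF
    have hF' := ReplicaForest.mem_forests.1 hF
    obtain ⟨M, hM⟩ := ReplicaForest.exists_norm_integral_forestOp_le hC hf hfL F
    have hae := ae_restrict_mem (μ := volume) (ReplicaForest.measurableSet_unitCube (F := F))
    refine Integrable.of_bound ?_ M ?_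
    -- Measurability is known for the complexified integral; the continuous left inverse `RCLike.map
    -- ℂ 𝕜` brings it back to `𝕜`.
    · have h1 := (RCLike.map ℂ 𝕜).continuous.comp_aestronglyMeasurable
        (ReplicaForest.aestronglyMeasurable_integral_forestOp hC hf' hfL' hF')
      refine h1.congr ?_
      filter_upwards [hae] with w hw
      rw [hcomm F hF w hw, ReplicaForest.map_complex_map]
    · filter_upwards [hae] with w hw
      exact (hM _ (ReplicaForest.posSemidef_forestMatrix hF' hw)
        fun i => ReplicaForest.forestMatrix_self w).1
  have hlhs := ReplicaForest.integrable_prod hf hfL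
  refine ⟨hlhs, fun F hF => ⟨fun w hw => ⟨?_, hint F hF w hw⟩, hcube F hF⟩, ?_⟩
  · exact ReplicaForest.posSemidef_forestMatrix (ReplicaForest.mem_forests.1 hF) hw
  -- The embedding into `ℂ` is continuous, real-linear and multiplicative, so it passes through
  -- integrals, derivatives and products.
  · apply ReplicaForest.map_complex_injective
    rw [← (RCLike.map 𝕜 ℂ).integral_comp_comm hlhs, map_sum]
    simp only [ReplicaForest.map_complex_prod]
    rw [ReplicaForest.integral_prod_eq_sum_forests_complex hC hf' hfL']
    refine Finset.sum_congr rfl fun F hF => ?_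
    rw [← (RCLike.map 𝕜 ℂ).integral_comp_comm (hcube F hF)]
    exact setIntegral_congr_fun ReplicaForest.measurableSet_unitCube
      fun w hw => hcomm F hF w hw
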